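/- Let $S_n$ be the symmetric group with simple transpositions $s_i=(i\;i+1)$, $1\le i\le n-1$, and Coxeter length $\ell$. A word $R=i_1\cdots i_L$ of length $L$ is a sequence of letters in $\{1,\dots,n-1\}$, not necessarily reduced. *Distribution.* For a finite field $\mathbb F_q$, let $E_\bullet$ be the standard complete flag in $\mathbb F_q^n$, let $B$ be the group of invertible upper triangular matrices, and for $w\in S_n$ let $X_w^\circ=B\cdot E^w_\bullet$, where $E^w_i=\langle e_{w(1)},\dots,e_{w(i)}\rangle$. Let $\mathrm{BS}^R$ be the set of sequences $(F^{(0)}_\bullet,\dots,F^{(L)}_\bullet)$ of complete flags in $\mathbb F_q^n$ with $F^{(0)}_\bullet=E_\bullet$ and $F^{(r-1)}_k=F^{(r)}_k$ for all $1\le r\le L$ and $k\ne i_r$, let $\pi_R$ be the projection to $F^{(L)}_\bullet$, and put $$\mathbb P_{R,q}(w)=\frac{|\pi_R^{-1}(X_w^\circ)|}{(q+1)^{L}}\qquad(w\in S_n).$$ Write $R\equiv R'$ if, for every $w\in S_n$, $\mathbb P_{R,q}(w)$ and $\mathbb P_{R',q}(w)$ are the same rational function of $q$, i.e. there is one rational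 function in $\mathbb Q(q)$ that has no pole at any prime power and whose value at every prime power $q$ is both $\mathbb P_{R,q}(w)$ and $\mathbb P_{R',q}(w)$. *Weights.* A subword $T$ of $R$ is a set of positions in $\{1,\dots,L\}$, and $w(T)$ is the product, from left to right, of the $s_{i_k}$ with $k\in T$. Put $x_0=e$, and for $1\le k\le L$ put $x_k=x_{k-1}s_{i_k}$ if $k\in T$ and $x_k=x_{k-1}$ otherwise. Call $k$ good if: $k\in T$ if and only if $\ell(x_{k-1}s_{i_k})>\ell(x_{k-1})$. Let $d(T)$ be the number of good $k$, and let $$\operatorname{wt}_R(x)=\sum_{T:\,w(T)=x}q^{d(T)}\in\mathbb Z[q]\qquad (x\in S_n).$$ *Hecke algebra.* Let $H_n(q)$ be the unital associative algebra over $\mathbb Z[q^{1/2},q^{-1/2}]$ ($q$ an indeterminate) with generators $T_1,\dots,T_{n-1}$ and relations $T_iT_j=T_jT_i$ for $|i-j|\ge 2$, $T_iT_{i+1}T_i=T_{i+1}T_iT_{i+1}$, and $T_i^2=(q-1)T_i+q$. For $x\in S_n$ let $T_x=T_{j_1}\cdots T_{j_\ell}$ for a reduced expression $x=s_{j_1}\cdots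 s_{j_\ell}$ (chosen arbitrarily; the product does not depend on the choice), and for a word $R=i_1\cdots i_L$ put $$F(R)=(1+T_{i_1})(1+T_{i_2})\cdots(1+T_{i_L}).$$ Then: 1. For every word $R$, $$F(R)=\sum_{x\in S_n}\operatorname{wt}_R(x)\,q^{-\ell(x)}\,T_x .$$ 2. For any two words $R,R'$ of the same length, $R\equiv R'$ if and only if $F(R)=F(R')$. Equivalently, $\mathbb P_{R,q}(w)=\mathbb P_{R',q}(w)$ for all prime powers $q$ and all $w\in S_n$ if and only if $F(R)=F(R')$. -/

import Mathlib

open scoped LaurentPolynomial Polynomial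

noncomputable section

namespace BottSamelson

/-! ### The symmetric group

A word of length `L` for `S_n` is a function `Fin L → Fin (n - 1)`. Letters, and the points on
which `S_n` acts, are counted from `0`: the letter `i : Fin (n - 1)` stands for the `(i+1)`-st
simple reflection. -/

/-- The simple transposition exchanging the points `i` and `i + 1` of `{0, …, n-1}`. -/
def simple {n : ℕ} (i : Fin (n - 1)) : Equiv.Perm (Fin n) :=
  Equiv.swap ⟨i, by omega⟩ ⟨i + 1, by omega⟩

/-- The ordinary product `w(R) = s_{i_1} s_{i_2} ⋯ s_{i_L}` of a word. -/
def wordPerm {n L : ℕ} (R : Fin L → Fin (n - 1)) : Equiv.Perm (Fin n) :=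
  (List.ofFn fun j => simple (R j)).prod

/-- The Coxeter length: the least length of a word with product `w`. -/
def coxLength {n : ℕ} (w : Equiv.Perm (Fin n)) : ℕ :=
  sInf {m : ℕ | ∃ R : Fin m → Fin (n - 1), wordPerm R = w}

theorem exists_word {n : ℕ} (w : Equiv.Perm (Fin n)) :
    ∃ (m : ℕ) (R : Fin m → Fin (n - 1)), wordPerm R = w := by
  cases n with
  | zero => exact ⟨0, Fin.elim0, Subsingleton.elim _ _⟩
  | succ n =>
    have hw : w ∈ Submonoid.closure
        (Set.range fun i : Fin n => Equiv.swap i.castSucc i.succ) := by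
      rw [Equiv.Perm.mclosure_swap_castSucc_succ]; trivial
    obtain ⟨l, hl, rfl⟩ := Submonoid.exists_list_of_mem_closure hw
    choose f hf using hl
    refine ⟨l.length, fun j => f (l.get j) (List.get_mem l j), ?_⟩
    have h : (fun j : Fin l.length =>
        simple (n := n + 1) (f (l.get j) (List.get_mem l j))) = l.get := by
      funext j
      exact hf _ (List.get_mem l j)
    unfold wordPerm
    rw [h, List.ofFn_get]

/-- Every permutation has a reduced word. -/
theorem exists_reducedWord {n : ℕ} (w : Equiv.Perm (Fin n)) :
    ∃ R : Fin (coxLength w) → Fin (n - 1), wordPerm R = w :=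
  Nat.sInf_mem (s := {m : ℕ | ∃ R : Fin m → Fin (n - 1), wordPerm R = w}) (exists_word w)

/-! ### Flags, Schubert cells and Bott–Samelson varieties -/

/-- A complete flag `0 = F_0 ⊂ F_1 ⊂ ⋯ ⊂ F_n = K^n` with `dim F_i = i`. -/
@[ext]
structure CompleteFlag (K : Type) [Field K] (n : ℕ) where
  space : Fin (n + 1) → Submodule K (Fin n → K)
  mono : Monotone space
  finrank_space : ∀ i, Module.finrank K (space i) = i

/-- The coordinate flag `E^w`, with `E^w_i` spanned by the first `i` of the vectors
`e_{w(0)}, e_{w(1)}, …`. -/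
def coordFlag (K : Type) [Field K] {n : ℕ} (w : Equiv.Perm (Fin n)) : CompleteFlag K n where
  space i := Submodule.span K
    ((fun j : Fin n => (Pi.single (w j) 1 : Fin n → K)) '' {j : Fin n | (j : ℕ) < i})
  mono := fun i k hik => Submodule.span_mono
    (Set.image_mono fun j (hj : (j : ℕ) < i) =>
      lt_of_lt_of_le hj (Fin.le_def.mp hik))
  finrank_space := fun i => by
    have hli : LinearIndependent K (fun j : Fin n => (Pi.single (w j) 1 : Fin n → K)) := by
      have h := (Pi.basisFun K (Fin n)).linearIndependent.comp w w.injective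
      convert h using 1
      funext j
      simp
    have hs : LinearIndependent K
        (fun j : {j : Fin n // (j : ℕ) < i} => (Pi.single (w j) 1 : Fin n → K)) :=
      hli.comp _ Subtype.val_injective
    have h := finrank_span_eq_card hs
    have hr : Set.range (fun j : {j : Fin n // (j : ℕ) < i} =>
        (Pi.single (w j) 1 : Fin n → K)) =
        (fun j : Fin n => (Pi.single (w j) 1 : Fin n → K)) '' {j : Fin n | (j : ℕ) < i} := by
      ext v
      simp
    rw [hr] at h
    rw [h, Fintype.card_subtype, Fin.card_filter_val_lt]
    omega

/-- The Schubert cell `B · E^w`, where `B` is the group of invertible upper triangular matrices. -/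
def schubertCell (K : Type) [Field K] {n : ℕ} (w : Equiv.Perm (Fin n)) :
    Set (CompleteFlag K n) :=
  {F | ∃ b : Matrix.GeneralLinearGroup (Fin n) K,
    (∀ i j : Fin n, j < i → (b : Matrix (Fin n) (Fin n) K) i j = 0) ∧
    ∀ k, F.space k =
      ((coordFlag K w).space k).map (Matrix.toLin' (b : Matrix (Fin n) (Fin n) K))}

/-- The points over `K` of the Bott–Samelson variety of `R`: sequences of flags
`F^{(0)}, …, F^{(L)}` starting at the standard flag, such that `F^{(r-1)}` and `F^{(r)}` agree
except possibly in the dimension of the `r`-th letter (dimension `i + 1` for the letter `i`,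
since letters are counted from `0`). -/
def Variety (K : Type) [Field K] {n L : ℕ} (R : Fin L → Fin (n - 1)) : Type :=
  {F : Fin (L + 1) → CompleteFlag K n //
    F 0 = coordFlag K 1 ∧
    ∀ (r : Fin L) (k : Fin (n + 1)), (k : ℕ) ≠ (R r : ℕ) + 1 →
      (F r.castSucc).space k = (F r.succ).space k}

/-- The Bott–Samelson map: projection to the last flag. -/
def proj (K : Type) [Field K] {n L : ℕ} (R : Fin L → Fin (n - 1)) (F : Variety K R) :
    CompleteFlag K n :=
  F.1 (Fin.last L)

/-- The distribution `ℙ_{R,q}` for `q = |K|`. -/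
def distribution (K : Type) [Field K] {n L : ℕ} (R : Fin L → Fin (n - 1))
    (w : Equiv.Perm (Fin n)) : ℚ :=
  (Nat.card (proj K R ⁻¹' schubertCell K w) : ℚ) / ((Nat.card K : ℚ) + 1) ^ L

/-- The rational function `f` of `q` is `q ↦ ℙ_{R,q}(w)`: at every prime power `q` it has no pole
and its value is `ℙ_{R,q}(w)`. -/
def IsRationalForm {n L : ℕ} (R : Fin L → Fin (n - 1)) (w : Equiv.Perm (Fin n))
    (f : RatFunc ℚ) : Prop :=
  ∀ (K : Type) [Field K] [Finite K],
    f.denom.eval (Nat.card K : ℚ) ≠ 0 ∧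
    f.eval (RingHom.id ℚ) (Nat.card K : ℚ) = distribution K R w

/-- `R ≡ R'`: for every `w`, `ℙ_{R,q}(w)` and `ℙ_{R',q}(w)` are the same rational function
of `q`. -/
def Equivalent {n L L' : ℕ} (R : Fin L → Fin (n - 1)) (R' : Fin L' → Fin (n - 1)) : Prop :=
  ∀ w : Equiv.Perm (Fin n), ∃ f : RatFunc ℚ, IsRationalForm R w f ∧ IsRationalForm R' w f

/-! ### Weighted subwords

A subword of `R` is a set `S` of positions in `R`. -/

/-- The state `x_k` of the subword `S` after the first `k` decisions. -/
def state {n L : ℕ} (R : Fin L → Fin (n - 1)) (S : Finset (Fin L)) : ℕ → Equiv.Perm (Fin n)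
  | 0 => 1
  | k + 1 =>
    if h : k < L then
      if (⟨k, h⟩ : Fin L) ∈ S then state R S k * simple (R ⟨k, h⟩) else state R S k
    else state R S k

/-- The decision at position `k` (counted from `0`) is good: the letter is selected exactly when
right multiplication by it increases the length of the current state. -/
def IsGood {n L : ℕ} (R : Fin L → Fin (n - 1)) (S : Finset (Fin L)) (k : Fin L) : Prop :=
  k ∈ S ↔ coxLength (state R S k) < coxLength (state R S k * simple (R k))

/-- The product `w(T)` of the selected letters, from left to right. -/
def subwordPerm {n L : ℕ} (R : Fin L → Fin (n - 1)) (S : Finset (Fin L)) : Equiv.Perm (Fin n) :=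
  (List.ofFn fun j => if j ∈ S then simple (R j) else 1).prod

open scoped Classical in
/-- The weight of a subword: `q` to the number of good decisions. -/
def subwordWt {n L : ℕ} (R : Fin L → Fin (n - 1)) (S : Finset (Fin L)) : ℤ[X] :=
  Polynomial.X ^ (Finset.univ.filter fun k : Fin L => IsGood R S k).card

/-- `wt_R(x)`, the sum of the weights of the subwords with product `x`, a polynomial in `q`. -/
def wt {n L : ℕ} (R : Fin L → Fin (n - 1)) (x : Equiv.Perm (Fin n)) : ℤ[X] :=
  ∑ S : Finset (Fin L) with subwordPerm R S = x, subwordWt R S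

/-! ### The Hecke algebra

The ground ring is `ℤ[v, v⁻¹]`, in which `LaurentPolynomial.T m` is `v ^ m`, and `q = v ^ 2`. -/

/-- The parameter `q = v ^ 2`. -/
def q : ℤ[T;T⁻¹] := LaurentPolynomial.T 2

/-- The defining relations of the Hecke algebra of type `A_{n-1}`. -/
inductive HeckeRel (n : ℕ) :
    FreeAlgebra ℤ[T;T⁻¹] (Fin (n - 1)) → FreeAlgebra ℤ[T;T⁻¹] (Fin (n - 1)) → Prop
  | comm (i j : Fin (n - 1)) (h : (i : ℕ) + 2 ≤ j ∨ (j : ℕ) + 2 ≤ i) :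
      HeckeRel n (FreeAlgebra.ι _ i * FreeAlgebra.ι _ j) (FreeAlgebra.ι _ j * FreeAlgebra.ι _ i)
  | braid (i j : Fin (n - 1)) (h : (i : ℕ) + 1 = j) :
      HeckeRel n (FreeAlgebra.ι _ i * FreeAlgebra.ι _ j * FreeAlgebra.ι _ i)
        (FreeAlgebra.ι _ j * FreeAlgebra.ι _ i * FreeAlgebra.ι _ j)
  | quadratic (i : Fin (n - 1)) :
      HeckeRel n (FreeAlgebra.ι _ i * FreeAlgebra.ι _ i) ((q - 1) • FreeAlgebra.ι _ i + q • 1)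

/-- The Hecke algebra `H_n(q)`, by generators and relations. -/
abbrev HeckeAlgebra (n : ℕ) : Type := RingQuot (HeckeRel n)

/-- The generator `T_i`. -/
def heckeGen {n : ℕ} (i : Fin (n - 1)) : HeckeAlgebra n :=
  RingQuot.mkAlgHom ℤ[T;T⁻¹] (HeckeRel n) (FreeAlgebra.ι _ i)

/-- `T_w`, the product of the generators along a reduced word of `w`. -/
def heckeT {n : ℕ} (w : Equiv.Perm (Fin n)) : HeckeAlgebra n :=
  (List.ofFn fun j => heckeGen ((exists_reducedWord w).choose j)).prod

/-- `q^{-ℓ(w)} T_w`. -/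
def heckeTTilde {n : ℕ} (w : Equiv.Perm (Fin n)) : HeckeAlgebra n :=
  (LaurentPolynomial.T (-2 * (coxLength w : ℤ)) : ℤ[T;T⁻¹]) • heckeT w

/-- `F(R) = (1 + T_{i_1}) (1 + T_{i_2}) ⋯ (1 + T_{i_L})`. -/
def heckeProduct {n L : ℕ} (R : Fin L → Fin (n - 1)) : HeckeAlgebra n :=
  (List.ofFn fun j => 1 + heckeGen (R j)).prod

end BottSamelson

end

/-! The weights `wt R` link the two sides, because they, the Hecke product and the point counts all
obey the same recursion in the last letter `i` of the word. Let `f(x)` be `1` if `x` has an ascent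
at `i` and `q` otherwise (`stepFactor`). Deleting the last letter gives `wt(x) = f(x) (wt'(x) +
wt'(x s_i))`, where `wt'` belongs to the shorter word (`wt_succ`).

On the Hecke side the normalised elements `q^{-ℓ(w)} T_w` are multiplied by `1 + T_i` according to
the transpose of this rule (`heckeTTilde_mul`), and the expansion of `F(R)` follows by induction. On
the geometric side the flags adjacent to a given flag in dimension `i + 1` form a projective line.
It meets exactly two Schubert cells, those of some `a` ascending at `i` and of `a s_i`, in `1` and
`q` points respectively. So the point counts satisfy the same recursion (`card_preimage_succ`), and
the distribution is `wt(q) / (q + 1)^L`.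

Each side then determines the weights. The product `F(R)` does so because the `T_w` are linearly
independent (`linearIndependent_heckeT`), which is read off from an explicit action on functions on
`S_n`; the needed rules for `T_w` rest on Matsumoto's theorem (`reducedProdEq`). The distributions
do so because a polynomial is determined by its values at the primes. -/

open scoped LaurentPolynomial Polynomial

noncomputable section

namespace BottSamelson

variable {n : ℕ}

/-! ### Inversions and length -/

/-- The smaller of the two points exchanged by a simple transposition. -/
def lo (i : Fin (n - 1)) : Fin n := ⟨i, by omega⟩

/-- The larger of the two points exchanged by a simple transposition. -/
def hi (i : Fin (n - 1)) : Fin n := ⟨i + 1, by omega⟩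

theorem simple_eq (i : Fin (n - 1)) : simple i = Equiv.swap (lo i) (hi i) := rfl

theorem lo_lt_hi (i : Fin (n - 1)) : lo i < hi i := by
  simp [lo, hi, Fin.lt_def]

theorem lo_ne_hi (i : Fin (n - 1)) : lo i ≠ hi i := (lo_lt_hi i).ne

@[simp] theorem simple_lo (i : Fin (n - 1)) : simple i (lo i) = hi i := Equiv.swap_apply_left _ _

@[simp] theorem simple_hi (i : Fin (n - 1)) : simple i (hi i) = lo i := Equiv.swap_apply_right _ _

theorem simple_of_ne {i : Fin (n - 1)} {a : Fin n} (h : a ≠ lo i) (h' : a ≠ hi i) :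
    simple i a = a := Equiv.swap_apply_of_ne_of_ne h h'

@[simp] theorem simple_mul_self (i : Fin (n - 1)) : simple i * simple i = 1 :=
  Equiv.swap_mul_self _ _

@[simp] theorem simple_simple (i : Fin (n - 1)) (a : Fin n) : simple i (simple i a) = a := by
  rw [← Equiv.Perm.mul_apply, simple_mul_self, Equiv.Perm.one_apply]

@[simp] theorem mul_simple_mul_simple (w : Equiv.Perm (Fin n)) (i : Fin (n - 1)) :
    w * simple i * simple i = w := by
  rw [mul_assoc, simple_mul_self, mul_one]

theorem simple_lt_simple {i : Fin (n - 1)} {a b : Fin n} (h : a < b)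
    (h' : ¬(a = lo i ∧ b = hi i)) : simple i a < simple i b := by
  simp only [simple_eq, Equiv.swap_apply_def, lo, hi, Fin.ext_iff, Fin.lt_def] at *
  split_ifs <;> (try dsimp only) <;> omega

/-- `w` has an ascent at `i`. -/
def Up (w : Equiv.Perm (Fin n)) (i : Fin (n - 1)) : Prop := w (lo i) < w (hi i)

instance (w : Equiv.Perm (Fin n)) (i : Fin (n - 1)) : Decidable (Up w i) :=
  inferInstanceAs (Decidable (_ < _))

theorem not_up_iff {w : Equiv.Perm (Fin n)} {i : Fin (n - 1)} : ¬ Up w i ↔ w (hi i) < w (lo i) := by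
  rw [Up, not_lt]
  exact ⟨fun h => lt_of_le_of_ne h fun h' => lo_ne_hi i (w.injective h').symm, le_of_lt⟩

theorem up_mul_simple {w : Equiv.Perm (Fin n)} {i : Fin (n - 1)} :
    Up (w * simple i) i ↔ ¬ Up w i := by
  rw [not_up_iff]; simp [Up]

theorem mul_simple_ne (w : Equiv.Perm (Fin n)) (i : Fin (n - 1)) : w * simple i ≠ w := by
  intro h
  have h1 := up_mul_simple (w := w) (i := i)
  rw [h] at h1
  exact (iff_not_self h1).elim

/-- The inversions of a permutation. -/
def inversions (w : Equiv.Perm (Fin n)) : Finset (Fin n × Fin n) :=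
  Finset.univ.filter fun p => p.1 < p.2 ∧ w p.2 < w p.1

theorem mem_inversions {w : Equiv.Perm (Fin n)} {a b : Fin n} :
    (a, b) ∈ inversions w ↔ a < b ∧ w b < w a := by simp [inversions]

/-- Applying `s_i` to both entries matches the inversions of `w` with those of `w s_i`. The pair
`(lo i, hi i)` is the only one whose order `s_i` reverses, and it is the one new inversion. -/
theorem card_inversions_mul_simple {w : Equiv.Perm (Fin n)} {i : Fin (n - 1)} (h : Up w i) :
    (inversions (w * simple i)).card = (inversions w).card + 1 := by
  have key : inversions (w * simple i) = insert (lo i, hi i) ((inversions w).map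
      ((simple i).prodCongr (simple i)).toEmbedding) := by
    ext ⟨a, b⟩
    rw [Finset.mem_insert, Finset.mem_map_equiv, Prod.mk.injEq]
    have hs : (((simple i).prodCongr (simple i)).symm (a, b)) = (simple i a, simple i b) := by
      simp [simple_eq]
    rw [hs, mem_inversions, mem_inversions, Equiv.Perm.mul_apply, Equiv.Perm.mul_apply]
    by_cases hab : a = lo i ∧ b = hi i
    · obtain ⟨rfl, rfl⟩ := hab
      simpa [lo_lt_hi, Up] using h
    · simp only [hab, false_or]
      refine and_congr_left fun hw => ⟨fun h1 => simple_lt_simple h1 hab, fun h1 => ?_⟩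
      have := simple_lt_simple (i := i) h1 (by
        rintro ⟨h2, h3⟩
        rw [h2, h3] at hw
        exact absurd h hw.not_gt)
      simpa using this
  rw [key, Finset.card_insert_of_notMem, Finset.card_map]
  rw [Finset.mem_map_equiv]
  intro h1
  have hs : (((simple i).prodCongr (simple i)).symm (lo i, hi i)) = (hi i, lo i) := by
    simp [simple_eq]
  rw [hs, mem_inversions] at h1
  exact absurd h1.1 (lo_lt_hi i).not_gt

theorem card_inversions_of_not_up {w : Equiv.Perm (Fin n)} {i : Fin (n - 1)} (h : ¬ Up w i) :
    (inversions w).card = (inversions (w * simple i)).card + 1 := by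
  simpa using card_inversions_mul_simple (up_mul_simple.2 h)

/-- Without descents `w` is strictly increasing, and a finite chain has only the trivial order
automorphism. -/
theorem eq_one_of_forall_up {w : Equiv.Perm (Fin n)} (h : ∀ i, Up w i) : w = 1 := by
  cases n with
  | zero => exact Subsingleton.elim _ _
  | succ n =>
    have hm : StrictMono w := Fin.strictMono_iff_lt_succ.2 fun i => h i
    have := Subsingleton.elim (hm.orderIsoOfSurjective w w.surjective) (OrderIso.refl _)
    ext a
    exact congrArg Fin.val (DFunLike.congr_fun this a)

/-- The product of the simple transpositions in a list of letters. -/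
def listPerm (l : List (Fin (n - 1))) : Equiv.Perm (Fin n) := (l.map simple).prod

@[simp] theorem listPerm_nil : listPerm ([] : List (Fin (n - 1))) = 1 := rfl

@[simp] theorem listPerm_append_singleton (l : List (Fin (n - 1))) (i : Fin (n - 1)) :
    listPerm (l ++ [i]) = listPerm l * simple i := by simp [listPerm]

theorem wordPerm_eq_listPerm {L : ℕ} (R : Fin L → Fin (n - 1)) :
    wordPerm R = listPerm (List.ofFn R) := by
  simp [wordPerm, listPerm, List.map_ofFn, Function.comp_def]

theorem card_inversions_le (l : List (Fin (n - 1))) :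
    (inversions (listPerm l)).card ≤ l.length := by
  induction l using List.reverseRecOn with
  | nil =>
    simp only [listPerm_nil, List.length_nil, Nat.le_zero, Finset.card_eq_zero]
    ext ⟨a, b⟩
    simpa [mem_inversions] using fun h : a < b => h.le
  | append_singleton l i ih =>
    rw [listPerm_append_singleton, List.length_append, List.length_singleton]
    by_cases h : Up (listPerm l) i
    · rw [card_inversions_mul_simple h]; omega
    · have := card_inversions_of_not_up h; omega

theorem exists_list_of_card_inversions (m : ℕ) : ∀ w : Equiv.Perm (Fin n),
    (inversions w).card = m → ∃ l : List (Fin (n - 1)), l.length = m ∧ listPerm l = w := by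
  induction m with
  | zero =>
    intro w hw
    refine ⟨[], rfl, (eq_one_of_forall_up fun i => ?_).symm⟩
    by_contra h
    have := card_inversions_of_not_up h
    omega
  | succ m ih =>
    intro w hw
    have : ∃ i, ¬ Up w i := by
      by_contra! h
      have h1 := eq_one_of_forall_up h
      have := card_inversions_le ([] : List (Fin (n - 1)))
      rw [listPerm_nil, ← h1, hw] at this
      simp at this
    obtain ⟨i, hi⟩ := this
    obtain ⟨l, hl, hlw⟩ := ih (w * simple i) (by have := card_inversions_of_not_up hi; omega)
    exact ⟨l ++ [i], by simp [hl], by simp [hlw]⟩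

/-- Each letter changes the number of inversions by one, so no word is shorter than that number.
Removing descents one at a time produces a word that attains it. -/
theorem coxLength_eq (w : Equiv.Perm (Fin n)) : coxLength w = (inversions w).card := by
  apply le_antisymm
  · obtain ⟨l, hl, hw⟩ := exists_list_of_card_inversions _ w rfl
    rw [← hl]
    exact Nat.sInf_le ⟨l.get, by rw [wordPerm_eq_listPerm, List.ofFn_get, hw]⟩
  · obtain ⟨R, hR⟩ := exists_reducedWord w
    have := card_inversions_le (List.ofFn R)
    rwa [← wordPerm_eq_listPerm, hR, List.length_ofFn] at this

theorem coxLength_lt_iff {w : Equiv.Perm (Fin n)} {i : Fin (n - 1)} :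
    coxLength w < coxLength (w * simple i) ↔ Up w i := by
  rw [coxLength_eq, coxLength_eq]
  by_cases h : Up w i
  · simp [h, card_inversions_mul_simple h]
  · simp [h, card_inversions_of_not_up h]

theorem coxLength_mul_simple {w : Equiv.Perm (Fin n)} {i : Fin (n - 1)} (h : Up w i) :
    coxLength (w * simple i) = coxLength w + 1 := by
  rw [coxLength_eq, coxLength_eq, card_inversions_mul_simple h]

/-! ### Reduced words -/

theorem hi_eq_lo {i j : Fin (n - 1)} (h : (i : ℕ) + 1 = j) : hi i = lo j := by
  simp [hi, lo, h]

theorem simple_fix {i j : Fin (n - 1)} (h : (i : ℕ) + 2 ≤ j ∨ (j : ℕ) + 2 ≤ i) :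
    simple i (lo j) = lo j ∧ simple i (hi j) = hi j := by
  constructor <;> apply simple_of_ne <;> simp only [lo, hi, ne_eq, Fin.ext_iff] <;> omega

theorem simple_comm {i j : Fin (n - 1)} (h : (i : ℕ) + 2 ≤ j ∨ (j : ℕ) + 2 ≤ i) :
    simple i * simple j = simple j * simple i := by
  apply (Equiv.Perm.Disjoint.commute ?_)
  intro a
  by_cases h1 : a = lo j
  · exact Or.inl (h1 ▸ (simple_fix h).1)
  by_cases h2 : a = hi j
  · exact Or.inl (h2 ▸ (simple_fix h).2)
  exact Or.inr (simple_of_ne h1 h2)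

theorem simple_braid {i j : Fin (n - 1)} (h : (i : ℕ) + 1 = j) :
    simple i * simple j * simple i = simple j * simple i * simple j := by
  have h1 : lo i ≠ hi j := by simp only [lo, hi, ne_eq, Fin.ext_iff]; omega
  rw [simple_eq, simple_eq, hi_eq_lo h]
  have h2 : lo i ≠ lo j := hi_eq_lo h ▸ lo_ne_hi i
  rw [Equiv.swap_mul_swap_mul_swap h2 h1, Equiv.swap_comm (lo i) (lo j),
    Equiv.swap_comm (lo j) (hi j), Equiv.swap_mul_swap_mul_swap (lo_ne_hi j).symm h1.symm,
    Equiv.swap_comm (lo i) (hi j)]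

theorem up_mul_simple_comm {i j : Fin (n - 1)} (h : (i : ℕ) + 2 ≤ j ∨ (j : ℕ) + 2 ≤ i)
    (w : Equiv.Perm (Fin n)) : Up (w * simple i) j ↔ Up w j := by
  simp [Up, simple_fix h]

theorem simple_fix_hi {i j : Fin (n - 1)} (h : (i : ℕ) + 1 = j) : simple i (hi j) = hi j := by
  apply simple_of_ne <;> simp only [lo, hi, ne_eq, Fin.ext_iff] <;> omega

theorem simple_fix_lo {i j : Fin (n - 1)} (h : (i : ℕ) + 1 = j) : simple j (lo i) = lo i := by
  apply simple_of_ne <;> simp only [lo, hi, ne_eq, Fin.ext_iff] <;> omega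

theorem card_inversions_mul_simple_of_not_up {m : ℕ} {w : Equiv.Perm (Fin n)} {i : Fin (n - 1)}
    (hw : (inversions w).card = m + 1) (h : ¬ Up w i) : (inversions (w * simple i)).card = m := by
  have := card_inversions_of_not_up h
  omega

theorem not_up_of_mul_simple {w : Equiv.Perm (Fin n)} {i : Fin (n - 1)}
    {l : List (Fin (n - 1))} (hw : (inversions w).card = l.length + 1)
    (hl : listPerm l = w * simple i) : ¬ Up w i := by
  intro h
  have := card_inversions_mul_simple h
  have := card_inversions_le l
  rw [hl] at this
  omega

/-- All reduced words of length `m` of the same permutation have the same product under `g`. -/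
def ReducedProdEq {M : Type*} [Monoid M] (g : Fin (n - 1) → M) (m : ℕ) : Prop :=
  ∀ l l' : List (Fin (n - 1)), l.length = m → l'.length = m → listPerm l = listPerm l' →
    (inversions (listPerm l)).card = m → (l.map g).prod = (l'.map g).prod

section Reduced

variable {M : Type*} [Monoid M] {g : Fin (n - 1) → M} {m : ℕ} {w : Equiv.Perm (Fin n)}
  {i j : Fin (n - 1)} {p p' : List (Fin (n - 1))}

/-- Induction step of Matsumoto's theorem for commuting last letters. Both are descents of `w`, so
`w s_i s_j` is shorter by two. If `u` is a reduced word of it, the induction hypothesis replaces `p`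
by `u j` and `p'` by `u i`, and the commutation relation finishes. -/
theorem prod_append_eq_of_comm (h : (i : ℕ) + 2 ≤ j ∨ (j : ℕ) + 2 ≤ i)
    (hc : g i * g j = g j * g i) (ih : ReducedProdEq g m)
    (hw : (inversions w).card = m + 1) (hpl : p.length = m) (hpl' : p'.length = m)
    (hpw : listPerm p = w * simple i) (hpw' : listPerm p' = w * simple j) :
    (p.map g).prod * g i = (p'.map g).prod * g j := by
  subst hpl
  have hi := not_up_of_mul_simple hw hpw
  have hj := not_up_of_mul_simple (hpl' ▸ hw) hpw'
  have hri := card_inversions_mul_simple_of_not_up hw hi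
  have hrj := card_inversions_mul_simple_of_not_up hw hj
  have hij : ¬ Up (w * simple i) j := by rwa [up_mul_simple_comm h]
  obtain ⟨k, hk⟩ : ∃ k, p.length = k + 1 := ⟨_, hri ▸ card_inversions_of_not_up hij⟩
  have hk' := card_inversions_mul_simple_of_not_up (hri.trans hk) hij
  obtain ⟨u, hu, huw⟩ := exists_list_of_card_inversions _ _ hk'
  have e1 : listPerm (u ++ [j]) = w * simple i := by
    rw [listPerm_append_singleton, huw, mul_simple_mul_simple]
  have e2 : listPerm (u ++ [i]) = w * simple j := by
    rw [listPerm_append_singleton, huw, mul_assoc w, simple_comm h, ← mul_assoc w,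
      mul_simple_mul_simple]
  rw [ih p (u ++ [j]) rfl (by simp [hu, hk]) (hpw.trans e1.symm) (by rw [hpw, hri]),
    ih p' (u ++ [i]) hpl' (by simp [hu, hk]) (hpw'.trans e2.symm) (by rw [hpw', hrj])]
  simp only [List.map_append, List.prod_append, List.map_cons, List.map_nil, List.prod_cons,
    List.prod_nil, mul_one, mul_assoc, hc]

/-- The same step for neighbouring letters. Descents at `i` and `j` make `w` decreasing on three
consecutive points, so `w s_i s_j s_i` is shorter by three. With `u` a reduced word of it, `p`
becomes `u i j` and `p'` becomes `u j i`. -/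
theorem prod_append_eq_of_braid (h : (i : ℕ) + 1 = j)
    (hb : g i * g j * g i = g j * g i * g j) (ih : ReducedProdEq g m)
    (hw : (inversions w).card = m + 1) (hpl : p.length = m) (hpl' : p'.length = m)
    (hpw : listPerm p = w * simple i) (hpw' : listPerm p' = w * simple j) :
    (p.map g).prod * g i = (p'.map g).prod * g j := by
  subst hpl
  have hi := not_up_of_mul_simple hw hpw
  have hj := not_up_of_mul_simple (hpl' ▸ hw) hpw'
  have hri := card_inversions_mul_simple_of_not_up hw hi
  have hrj := card_inversions_mul_simple_of_not_up hw hj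
  have e := hi_eq_lo h
  have e1 := simple_fix_hi h
  have e2 := simple_fix_lo h
  have hi0 := not_up_iff.1 hi
  have hj0 := not_up_iff.1 hj
  have hij : ¬ Up (w * simple i) j := by
    rw [not_up_iff, Equiv.Perm.mul_apply, Equiv.Perm.mul_apply, e1, ← e, simple_hi]
    exact hj0.trans (e ▸ hi0)
  have hiji : ¬ Up (w * simple i * simple j) i := by
    rw [not_up_iff, e]
    simp only [Equiv.Perm.mul_apply, simple_lo, e1, e2]
    rwa [e]
  obtain ⟨k, hk⟩ : ∃ k, p.length = k + 1 := ⟨_, hri ▸ card_inversions_of_not_up hij⟩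
  have hk' := card_inversions_mul_simple_of_not_up (hri.trans hk) hij
  obtain ⟨k, rfl⟩ : ∃ k', k = k' + 1 := ⟨_, hk' ▸ card_inversions_of_not_up hiji⟩
  have hk'' := card_inversions_mul_simple_of_not_up hk' hiji
  obtain ⟨u, hu, huw⟩ := exists_list_of_card_inversions _ _ hk''
  have f1 : listPerm (u ++ [i] ++ [j]) = w * simple i := by
    simp only [listPerm_append_singleton, huw, mul_simple_mul_simple]
  have f2 : listPerm (u ++ [j] ++ [i]) = w * simple j := by
    have : w * simple i * simple j * simple i = w * simple j * simple i * simple j := by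
      simp only [mul_assoc] at *
      rw [← mul_assoc (simple i), simple_braid h, mul_assoc]
    rw [listPerm_append_singleton, listPerm_append_singleton, huw, this]
    simp only [mul_simple_mul_simple]
  rw [ih p (u ++ [i] ++ [j]) rfl (by simp [hu, hk]) (hpw.trans f1.symm) (by rw [hpw, hri]),
    ih p' (u ++ [j] ++ [i]) hpl' (by simp [hu, hk]) (hpw'.trans f2.symm) (by rw [hpw', hrj])]
  simp only [mul_assoc] at hb
  simp only [List.map_append, List.prod_append, List.map_cons, List.map_nil, List.prod_cons,
    List.prod_nil, mul_one, mul_assoc, hb]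

end Reduced

/-- Two reduced words of the same permutation have the same product in every monoid in which the
braid relations hold. -/
theorem reducedProdEq {M : Type*} [Monoid M] (g : Fin (n - 1) → M)
    (hc : ∀ i j : Fin (n - 1), ((i : ℕ) + 2 ≤ j ∨ (j : ℕ) + 2 ≤ i) → g i * g j = g j * g i)
    (hb : ∀ i j : Fin (n - 1), (i : ℕ) + 1 = j → g i * g j * g i = g j * g i * g j) (m : ℕ) :
    ReducedProdEq g m := by
  induction m with
  | zero =>
    intro l l' hl hl' _ _
    rw [List.length_eq_zero_iff.1 hl, List.length_eq_zero_iff.1 hl']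
  | succ m ih =>
    intro l l' hl hl' hp hr
    rcases l.eq_nil_or_concat' with rfl | ⟨p, i, rfl⟩
    · simp at hl
    rcases l'.eq_nil_or_concat' with rfl | ⟨p', j, rfl⟩
    · simp at hl'
    obtain ⟨w, hw⟩ : ∃ w, w = listPerm (p ++ [i]) := ⟨_, rfl⟩
    rw [← hw] at hp hr
    have hpl : p.length = m := by simpa using hl
    have hpl' : p'.length = m := by simpa using hl'
    have hpw : listPerm p = w * simple i := by simp [hw]
    have hpw' : listPerm p' = w * simple j := by simp [hp]
    simp only [List.map_append, List.prod_append, List.map_cons, List.map_nil, List.prod_cons,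
      List.prod_nil, mul_one]
    by_cases h1 : (i : ℕ) + 2 ≤ j ∨ (j : ℕ) + 2 ≤ i
    · exact prod_append_eq_of_comm h1 (hc i j h1) ih hr hpl hpl' hpw hpw'
    by_cases h2 : (i : ℕ) + 1 = j
    · exact prod_append_eq_of_braid h2 (hb i j h2) ih hr hpl hpl' hpw hpw'
    by_cases h3 : (j : ℕ) + 1 = i
    · exact (prod_append_eq_of_braid h3 (hb j i h3) ih hr hpl' hpl hpw' hpw).symm
    -- With equal last letters, `p` and `p'` are reduced words of the same permutation.
    obtain rfl : i = j := Fin.ext (by omega)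
    have hi := not_up_of_mul_simple (hpl.symm ▸ hr) hpw
    rw [ih p p' hpl hpl' (hpw.trans hpw'.symm)
      (by rw [hpw, card_inversions_mul_simple_of_not_up hr hi])]

/-! ### Recursion for the weights -/

theorem sum_finset_fin_succ {M : Type*} [AddCommMonoid M] {L : ℕ}
    (f : Finset (Fin (L + 1)) → M) :
    ∑ S, f S = ∑ S : Finset (Fin L), (f (S.map Fin.castSuccEmb) +
      f (insert (Fin.last L) (S.map Fin.castSuccEmb))) := by
  have h : Fin.last L ∉ (Finset.univ : Finset (Fin L)).map Fin.castSuccEmb := by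
    simp [Fin.castSucc_ne_last]
  have hm : ((Finset.univ : Finset (Fin L)).map Fin.castSuccEmb).powerset =
      (Finset.univ : Finset (Finset (Fin L))).map (Finset.mapEmbedding Fin.castSuccEmb).toEmbedding := by
    ext S
    simp only [Finset.mem_powerset, Finset.mem_map, Finset.mem_univ, true_and,
      Finset.subset_map_iff]
    simp [eq_comm]
  rw [← Finset.powerset_univ, Fin.univ_castSuccEmb, Finset.cons_eq_insert,
    Finset.sum_powerset_insert h, hm, Finset.sum_map, Finset.sum_map, ← Finset.sum_add_distrib]
  rfl

section Weights

variable {L : ℕ} (R : Fin (L + 1) → Fin (n - 1))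

theorem state_init {S : Finset (Fin L)} {S' : Finset (Fin (L + 1))}
    (h : ∀ j : Fin L, j.castSucc ∈ S' ↔ j ∈ S) :
    ∀ k ≤ L, state R S' k = state (Fin.init R) S k
  | 0, _ => rfl
  | k + 1, hk => by
    have h1 : k < L + 1 := by omega
    have h2 : k < L := hk
    have h3 : (⟨k, h1⟩ : Fin (L + 1)) ∈ S' ↔ (⟨k, h2⟩ : Fin L) ∈ S := h ⟨k, h2⟩
    simp only [state, h1, h2, dif_pos, h3, state_init h k h2.le]
    rfl

theorem subwordPerm_eq_state : ∀ {L : ℕ} (R : Fin L → Fin (n - 1)) (S : Finset (Fin L)),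
    subwordPerm R S = state R S L
  | 0, R, S => by simp [subwordPerm, state]
  | L + 1, R, S => by
    have hS : ∀ j : Fin L, j.castSucc ∈ S ↔
        j ∈ Finset.univ.filter fun j : Fin L => j.castSucc ∈ S := by simp
    have ih := subwordPerm_eq_state (Fin.init R) (Finset.univ.filter fun j => j.castSucc ∈ S)
    rw [← state_init R hS L le_rfl] at ih
    simp only [state, Nat.lt_succ_self, dif_pos]
    rw [← ih, subwordPerm, List.ofFn_succ', List.concat_eq_append, List.prod_append]
    simp only [subwordPerm, Finset.mem_filter, Finset.mem_univ, true_and, List.prod_singleton]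
    change _ * (if Fin.last L ∈ S then simple (R (Fin.last L)) else 1) =
      if Fin.last L ∈ S then _ * simple (R (Fin.last L)) else _
    split_ifs
    · rfl
    · exact mul_one _

open scoped Classical in
theorem subwordWt_eq_prod {L : ℕ} (R : Fin L → Fin (n - 1)) (S : Finset (Fin L)) :
    subwordWt R S = ∏ k, if IsGood R S k then Polynomial.X else 1 := by
  rw [Finset.prod_ite, Finset.prod_const, Finset.prod_const_one, mul_one, subwordWt]

theorem isGood_init {S : Finset (Fin L)} {S' : Finset (Fin (L + 1))}
    (h : ∀ j : Fin L, j.castSucc ∈ S' ↔ j ∈ S) (k : Fin L) :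
    IsGood R S' k.castSucc ↔ IsGood (Fin.init R) S k := by
  rw [IsGood, IsGood, h, Fin.val_castSucc, state_init R h k k.2.le]
  rfl

open scoped Classical in
-- Whether a decision is good depends only on the earlier ones, so the weight is that of the
-- truncated subword times one factor for the last letter.
theorem subwordWt_init {S : Finset (Fin L)} {S' : Finset (Fin (L + 1))}
    (h : ∀ j : Fin L, j.castSucc ∈ S' ↔ j ∈ S) :
    subwordWt R S' = subwordWt (Fin.init R) S *
      if (Fin.last L ∈ S' ↔ Up (subwordPerm (Fin.init R) S) (R (Fin.last L)))
        then Polynomial.X else 1 := by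
  have h1 : IsGood R S' (Fin.last L) ↔
      (Fin.last L ∈ S' ↔ Up (subwordPerm (Fin.init R) S) (R (Fin.last L))) := by
    rw [IsGood, coxLength_lt_iff, Fin.val_last, state_init R h L le_rfl, subwordPerm_eq_state]
  simp only [subwordWt_eq_prod, Fin.prod_univ_castSucc, isGood_init R h, h1]

theorem subwordPerm_init {S : Finset (Fin L)} {S' : Finset (Fin (L + 1))}
    (h : ∀ j : Fin L, j.castSucc ∈ S' ↔ j ∈ S) :
    subwordPerm R S' = if Fin.last L ∈ S' then
      subwordPerm (Fin.init R) S * simple (R (Fin.last L)) else subwordPerm (Fin.init R) S := by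
  rw [subwordPerm_eq_state, subwordPerm_eq_state, ← state_init R h L le_rfl]
  simp only [state, Nat.lt_succ_self, dif_pos]
  rfl

/-- The factor contributed by a step ending at `x`: `1` at an ascent and `q` at a descent. -/
def stepFactor {A : Type*} [One A] (a : A) (x : Equiv.Perm (Fin n)) (i : Fin (n - 1)) : A :=
  if Up x i then 1 else a

theorem wt_eq_sum_ite {L : ℕ} (R : Fin L → Fin (n - 1)) (x : Equiv.Perm (Fin n)) :
    wt R x = ∑ S, if subwordPerm R S = x then subwordWt R S else 0 :=
  Finset.sum_filter _ _

theorem mul_simple_eq_iff {w x : Equiv.Perm (Fin n)} {i : Fin (n - 1)} :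
    w * simple i = x ↔ w = x * simple i := by
  constructor <;> rintro rfl <;> simp

/-- A subword ending at `x` was before its last letter at `x` (letter skipped) or at `x s_i` (letter
selected). In either case the last decision is good exactly when `x` has a descent at `i`, so the
two cases share one factor. -/
theorem wt_succ (x : Equiv.Perm (Fin n)) :
    wt R x = (wt (Fin.init R) x + wt (Fin.init R) (x * simple (R (Fin.last L)))) *
      stepFactor Polynomial.X x (R (Fin.last L)) := by
  rw [wt_eq_sum_ite, sum_finset_fin_succ, Finset.sum_add_distrib, add_mul]
  congr 1
  · rw [wt_eq_sum_ite, Finset.sum_mul]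
    refine Finset.sum_congr rfl fun S _ => ?_
    have h : ∀ j : Fin L, j.castSucc ∈ S.map Fin.castSuccEmb ↔ j ∈ S := by simp
    have hl : Fin.last L ∉ S.map Fin.castSuccEmb := by simp [Fin.castSucc_ne_last]
    rw [subwordPerm_init R h, subwordWt_init R h, if_neg hl]
    simp only [hl, false_iff]
    by_cases h1 : subwordPerm (Fin.init R) S = x
    · by_cases h2 : Up x (R (Fin.last L)) <;> simp [stepFactor, h1, h2]
    · simp [h1]
  · rw [wt_eq_sum_ite, Finset.sum_mul]
    refine Finset.sum_congr rfl fun S _ => ?_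
    have h : ∀ j : Fin L, j.castSucc ∈ insert (Fin.last L) (S.map Fin.castSuccEmb) ↔ j ∈ S := by
      simp [Fin.castSucc_ne_last]
    have hl : Fin.last L ∈ insert (Fin.last L) (S.map Fin.castSuccEmb) := by simp
    rw [subwordPerm_init R h, subwordWt_init R h, if_pos hl]
    simp only [hl, true_iff, mul_simple_eq_iff]
    by_cases h1 : subwordPerm (Fin.init R) S = x * simple (R (Fin.last L))
    · by_cases h2 : Up x (R (Fin.last L)) <;> simp [stepFactor, h1, h2, up_mul_simple]
    · simp [h1]

theorem wt_zero (R : Fin 0 → Fin (n - 1)) (x : Equiv.Perm (Fin n)) :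
    wt R x = if x = 1 then 1 else 0 := by
  rw [wt_eq_sum_ite, Fintype.sum_unique]
  simp [subwordPerm, subwordWt, eq_comm]

end Weights

/-! ### The Hecke algebra -/

theorem heckeGen_comm {i j : Fin (n - 1)} (h : (i : ℕ) + 2 ≤ j ∨ (j : ℕ) + 2 ≤ i) :
    heckeGen i * heckeGen j = heckeGen j * heckeGen i := by
  simpa only [map_mul, heckeGen] using RingQuot.mkAlgHom_rel ℤ[T;T⁻¹] (HeckeRel.comm i j h)

theorem heckeGen_braid {i j : Fin (n - 1)} (h : (i : ℕ) + 1 = j) :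
    heckeGen i * heckeGen j * heckeGen i = heckeGen j * heckeGen i * heckeGen j := by
  simpa only [map_mul, heckeGen] using RingQuot.mkAlgHom_rel ℤ[T;T⁻¹] (HeckeRel.braid i j h)

theorem heckeGen_mul_self (i : Fin (n - 1)) :
    heckeGen i * heckeGen i = (q - 1) • heckeGen i + q • (1 : HeckeAlgebra n) := by
  simpa only [map_mul, map_add, map_smul, map_one, heckeGen] using
    RingQuot.mkAlgHom_rel ℤ[T;T⁻¹] (HeckeRel.quadratic i)

/-- Matsumoto's theorem frees `heckeT` from the reduced word chosen in its definition. -/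
theorem heckeT_eq {w : Equiv.Perm (Fin n)} {l : List (Fin (n - 1))} (hl : l.length = coxLength w)
    (hw : listPerm l = w) : heckeT w = (l.map heckeGen).prod := by
  have h : listPerm (List.ofFn (exists_reducedWord w).choose) = w := by
    rw [← wordPerm_eq_listPerm, (exists_reducedWord w).choose_spec]
  have := reducedProdEq heckeGen (fun _ _ => heckeGen_comm) (fun _ _ => heckeGen_braid)
    (coxLength w) (List.ofFn (exists_reducedWord w).choose) l (by simp) hl (h.trans hw.symm)
    (by rw [h, coxLength_eq])
  rw [← this, heckeT, List.map_ofFn]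
  rfl

theorem coxLength_one : coxLength (1 : Equiv.Perm (Fin n)) = 0 := by
  rw [coxLength_eq, ← Nat.le_zero]
  exact card_inversions_le []

theorem heckeT_one : heckeT (1 : Equiv.Perm (Fin n)) = 1 := by
  rw [heckeT_eq (l := []) (by simp [coxLength_one]) listPerm_nil, List.map_nil, List.prod_nil]

theorem heckeT_mul_simple {w : Equiv.Perm (Fin n)} {i : Fin (n - 1)} (h : Up w i) :
    heckeT (w * simple i) = heckeT w * heckeGen i := by
  obtain ⟨l, hl, hw⟩ := exists_list_of_card_inversions _ w rfl
  rw [← coxLength_eq] at hl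
  rw [heckeT_eq hl hw, heckeT_eq (l := l ++ [i]) (by simp [hl, coxLength_mul_simple h])
    (by simp [hw])]
  simp

theorem heckeT_mul_gen_of_not_up {w : Equiv.Perm (Fin n)} {i : Fin (n - 1)} (h : ¬ Up w i) :
    heckeT w * heckeGen i = (q - 1) • heckeT w + q • heckeT (w * simple i) := by
  have h1 := heckeT_mul_simple (up_mul_simple.2 h)
  rw [mul_simple_mul_simple] at h1
  rw [h1, mul_assoc, heckeGen_mul_self]
  simp [mul_add]

/-- The factor `q^{-ℓ(w)}` is what makes each coefficient depend only on the basis element it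
multiplies, not on the one it came from. This matches the recursion for the weights. -/
theorem heckeTTilde_mul (w : Equiv.Perm (Fin n)) (i : Fin (n - 1)) :
    heckeTTilde w * (1 + heckeGen i) = stepFactor q w i • heckeTTilde w +
      stepFactor q (w * simple i) i • heckeTTilde (w * simple i) := by
  by_cases h : Up w i
  · have h' : ¬ Up (w * simple i) i := by rwa [up_mul_simple, not_not]
    have e : q * LaurentPolynomial.T (-2 * ((coxLength w : ℤ) + 1)) =
        LaurentPolynomial.T (-2 * (coxLength w : ℤ)) := by
      rw [q, ← LaurentPolynomial.T_add]; congr 1; ring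
    rw [stepFactor, stepFactor, if_pos h, if_neg h', heckeTTilde, heckeTTilde,
      heckeT_mul_simple h, coxLength_mul_simple h, mul_add, mul_one, one_smul, smul_smul,
      smul_mul_assoc]
    push_cast
    rw [e]
  · have h' := up_mul_simple.2 h
    have hl := coxLength_mul_simple h'
    rw [mul_simple_mul_simple] at hl
    have e : LaurentPolynomial.T (-2 * ((coxLength (w * simple i) : ℤ) + 1)) * q =
        LaurentPolynomial.T (-2 * (coxLength (w * simple i) : ℤ)) := by
      rw [q, ← LaurentPolynomial.T_add]; congr 1; ring
    rw [stepFactor, stepFactor, if_neg h, if_pos h', heckeTTilde, heckeTTilde, smul_mul_assoc,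
      mul_add, mul_one, heckeT_mul_gen_of_not_up h, hl, one_smul]
    push_cast
    rw [← e]
    module

theorem heckeProduct_succ {L : ℕ} (R : Fin (L + 1) → Fin (n - 1)) :
    heckeProduct R = heckeProduct (Fin.init R) * (1 + heckeGen (R (Fin.last L))) := by
  rw [heckeProduct, List.ofFn_succ', List.concat_eq_append, List.prod_append, List.prod_singleton]
  rfl

theorem sum_smul_mul {k A : Type*} [CommSemiring k] [Semiring A] [Algebra k A]
    {t : Equiv.Perm (Fin n) → A} {g : A} {i : Fin (n - 1)} {c : Equiv.Perm (Fin n) → k}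
    (a : Equiv.Perm (Fin n) → k)
    (h : ∀ x, t x * g = c x • t x + c (x * simple i) • t (x * simple i)) :
    (∑ x, a x • t x) * g = ∑ x, ((a x + a (x * simple i)) * c x) • t x := by
  simp only [Finset.sum_mul, smul_mul_assoc, h, smul_add, smul_smul, add_mul, add_smul,
    Finset.sum_add_distrib]
  congr 1
  -- Right multiplication by `s_i` is an involution, so reindexing moves the second half of the sum
  -- to the target element.
  refine Fintype.sum_equiv (Equiv.mulRight (simple i)) _ _ fun x => ?_
  rw [Equiv.coe_mulRight, mul_simple_mul_simple]

/-- The expansion of `F(R)` in terms of the weights. -/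
theorem heckeProduct_eq_sum {L : ℕ} (R : Fin L → Fin (n - 1)) :
    heckeProduct R = ∑ x, Polynomial.aeval q (wt R x) • heckeTTilde x := by
  induction L with
  | zero =>
    rw [Finset.sum_eq_single 1]
    · simp [wt_zero, heckeProduct, heckeTTilde, coxLength_one, heckeT_one]
    · intro x _ hx
      rw [wt_zero, if_neg hx, map_zero, zero_smul]
    · simp
  | succ L ih =>
    have hf : ∀ x : Equiv.Perm (Fin n), Polynomial.aeval q
        (stepFactor (Polynomial.X : ℤ[X]) x (R (Fin.last L))) = stepFactor q x (R (Fin.last L)) := by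
      intro x
      unfold stepFactor
      split_ifs
      · exact map_one _
      · exact Polynomial.aeval_X _
    rw [heckeProduct_succ, ih, sum_smul_mul _ (fun x => heckeTTilde_mul x _)]
    simp only [wt_succ, map_mul, map_add, hf]

/-! ### Linear independence of the `T_w` -/

/-- The operator by which `T_i` acts on the functions on `S_n`. -/
def heckeOp (i : Fin (n - 1)) : Module.End ℤ[T;T⁻¹] (Equiv.Perm (Fin n) → ℤ[T;T⁻¹]) where
  toFun f x := if Up x i then f (x * simple i) else q * f (x * simple i) + (q - 1) * f x
  map_add' f g := by
    funext x
    simp only [Pi.add_apply]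
    split_ifs <;> ring
  map_smul' c f := by
    funext x
    simp only [Pi.smul_apply, smul_eq_mul, RingHom.id_apply]
    split_ifs <;> ring

theorem heckeOp_apply (i : Fin (n - 1)) (f : Equiv.Perm (Fin n) → ℤ[T;T⁻¹])
    (x : Equiv.Perm (Fin n)) : heckeOp i f x =
      if Up x i then f (x * simple i) else q * f (x * simple i) + (q - 1) * f x := rfl

theorem heckeOp_of_up {i : Fin (n - 1)} {x : Equiv.Perm (Fin n)} (h : Up x i)
    (f : Equiv.Perm (Fin n) → ℤ[T;T⁻¹]) : heckeOp i f x = f (x * simple i) := if_pos h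

theorem heckeOp_of_not_up {i : Fin (n - 1)} {x : Equiv.Perm (Fin n)} (h : ¬ Up x i)
    (f : Equiv.Perm (Fin n) → ℤ[T;T⁻¹]) :
    heckeOp i f x = q * f (x * simple i) + (q - 1) * f x := if_neg h

theorem heckeOp_mul_self (i : Fin (n - 1)) :
    heckeOp i * heckeOp i = (q - 1) • heckeOp i + q • (1 : Module.End ℤ[T;T⁻¹] _) := by
  refine LinearMap.ext fun f => funext fun x => ?_
  by_cases h : Up x i
  · have h' : ¬ Up (x * simple i) i := by rwa [up_mul_simple, not_not]
    simp [heckeOp_of_up h, heckeOp_of_not_up h']; ring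
  · have h' := up_mul_simple.2 h
    simp [heckeOp_of_up h', heckeOp_of_not_up h]; ring

theorem heckeOp_comm {i j : Fin (n - 1)} (h : (i : ℕ) + 2 ≤ j ∨ (j : ℕ) + 2 ≤ i) :
    heckeOp i * heckeOp j = heckeOp j * heckeOp i := by
  refine LinearMap.ext fun f => funext fun x => ?_
  have e : x * simple j * simple i = x * simple i * simple j := by
    rw [mul_assoc, mul_assoc, simple_comm h]
  simp only [Module.End.mul_apply, heckeOp_apply, up_mul_simple_comm h,
    up_mul_simple_comm h.symm, e]
  split_ifs <;> ring

theorem heckeOp_braid {i j : Fin (n - 1)} (h : (i : ℕ) + 1 = j) :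
    heckeOp i * heckeOp j * heckeOp i = heckeOp j * heckeOp i * heckeOp j := by
  refine LinearMap.ext fun f => funext fun x => ?_
  have e := hi_eq_lo h
  have e1 := simple_fix_hi h
  have e2 := simple_fix_lo h
  have b : x * simple j * simple i * simple j = x * simple i * simple j * simple i := by
    have := simple_braid h
    simp only [mul_assoc] at this ⊢
    rw [this]
  have hlt : x (lo i) ≠ x (hi j) := x.injective.ne (by simp only [lo, hi, ne_eq, Fin.ext_iff]; omega)
  have hlt' : x (lo i) ≠ x (lo j) := x.injective.ne (e ▸ lo_ne_hi i)
  have hlt'' : x (lo j) ≠ x (hi j) := x.injective.ne (lo_ne_hi j)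
  have s1 : simple i (lo j) = lo i := e ▸ simple_hi i
  have s2 : simple i (lo i) = lo j := e ▸ simple_lo i
  simp only [Module.End.mul_apply, heckeOp_apply, Up, e, e1, e2, s1, s2, Equiv.Perm.mul_apply,
    simple_lo, simple_hi, mul_simple_mul_simple, b]
  -- The operators see only the relative order of the values of `x` at three consecutive points. Of
  -- the eight sign patterns, two contradict transitivity.
  rcases lt_or_gt_of_ne hlt with h1 | h1 <;> rcases lt_or_gt_of_ne hlt' with h2 | h2 <;>
    rcases lt_or_gt_of_ne hlt'' with h3 | h3 <;>
    first
    | exact absurd (h2.trans h3) h1.not_gt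
    | exact absurd (h3.trans h2) h1.not_gt
    | (simp only [h1, h2, h3, h1.not_gt, h2.not_gt, h3.not_gt, if_true, if_false]; try ring)

/-- The Hecke algebra acts on the functions on `S_n`. -/
def heckeRep (n : ℕ) :
    HeckeAlgebra n →ₐ[ℤ[T;T⁻¹]] Module.End ℤ[T;T⁻¹] (Equiv.Perm (Fin n) → ℤ[T;T⁻¹]) :=
  RingQuot.liftAlgHom ℤ[T;T⁻¹] ⟨FreeAlgebra.lift ℤ[T;T⁻¹] heckeOp, by
    intro a b h
    cases h with
    | comm i j h => simpa using heckeOp_comm h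
    | braid i j h => simpa using heckeOp_braid h
    | quadratic i => simpa using heckeOp_mul_self i⟩

theorem heckeRep_gen (i : Fin (n - 1)) : heckeRep n (heckeGen i) = heckeOp i := by
  simp [heckeRep, heckeGen]

/-- The operators are transposed to right multiplication: if `f` is regarded as a functional with
`f(T_x) = f x`, then `T_i` sends it to `h ↦ f(h T_i)`. Hence `T_w` followed by evaluation at `1`
returns `f w`, and indicator functions separate the `T_w`. -/
theorem heckeRep_T (m : ℕ) : ∀ w : Equiv.Perm (Fin n), coxLength w = m →
    ∀ f, heckeRep n (heckeT w) f 1 = f w := by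
  induction m with
  | zero =>
    intro w hw f
    rw [coxLength_eq] at hw
    obtain ⟨l, hl, rfl⟩ := exists_list_of_card_inversions _ w hw
    obtain rfl := List.length_eq_zero_iff.1 hl
    simp [heckeT_one]
  | succ m ih =>
    intro w hw f
    have hw' := hw
    rw [coxLength_eq] at hw'
    obtain ⟨l, hl, hlw⟩ := exists_list_of_card_inversions _ w hw'
    obtain ⟨p, i, rfl⟩ : ∃ p i, l = p ++ [i] :=
      (l.eq_nil_or_concat').resolve_left (by rintro rfl; simp at hl)
    have hi : ¬ Up w i := not_up_of_mul_simple (l := p) (by simp at hl; omega) (by simp [← hlw])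
    have h := up_mul_simple.2 hi
    have e := heckeT_mul_simple h
    have e' := coxLength_mul_simple h
    rw [mul_simple_mul_simple] at e e'
    rw [e, map_mul, heckeRep_gen, Module.End.mul_apply, ih _ (by omega), heckeOp_of_up h,
      mul_simple_mul_simple]

theorem linearIndependent_heckeT :
    LinearIndependent ℤ[T;T⁻¹] (heckeT : Equiv.Perm (Fin n) → HeckeAlgebra n) := by
  rw [Fintype.linearIndependent_iffₛ]
  intro c d hc w
  have h := congrArg (fun a => heckeRep n a (Pi.single w 1) 1) hc
  simpa [heckeRep_T _ _ rfl, Pi.single_apply] using h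

/-- Since `q = v ^ 2`, evaluation at `q` is the substitution `X ↦ X ^ 2` followed by the inclusion
of polynomials into Laurent polynomials. -/
theorem aeval_q_injective : Function.Injective (Polynomial.aeval q : ℤ[X] → ℤ[T;T⁻¹]) := by
  have h : ∀ p : ℤ[X], Polynomial.aeval q p = Polynomial.toLaurent (Polynomial.expand ℤ 2 p) := by
    intro p
    induction p using Polynomial.induction_on' with
    | add a b ha hb => simp only [map_add, ha, hb]
    | monomial k a =>
      rw [Polynomial.expand_monomial, Polynomial.aeval_monomial,
        Polynomial.toLaurent_C_mul_T, q, LaurentPolynomial.T_pow]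
      push_cast
      rw [mul_comm (k : ℤ)]
      rfl
  intro a b hab
  rw [h, h] at hab
  exact Polynomial.expand_injective two_pos (Polynomial.toLaurent_injective hab)

theorem heckeProduct_eq_iff {L L' : ℕ} (R : Fin L → Fin (n - 1)) (R' : Fin L' → Fin (n - 1)) :
    heckeProduct R = heckeProduct R' ↔ ∀ x, wt R x = wt R' x := by
  constructor
  · intro h x
    rw [heckeProduct_eq_sum, heckeProduct_eq_sum] at h
    simp only [heckeTTilde, smul_smul] at h
    have := (Fintype.linearIndependent_iffₛ.1 linearIndependent_heckeT) _ _ h x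
    exact aeval_q_injective ((LaurentPolynomial.isUnit_T _).mul_left_injective this)
  · intro h
    rw [heckeProduct_eq_sum, heckeProduct_eq_sum]
    simp only [h]

/-! ### Flags -/

section Flags

variable {K : Type} [Field K]

theorem mem_coordFlag {w : Equiv.Perm (Fin n)} {k : Fin (n + 1)} {v : Fin n → K} :
    v ∈ (coordFlag K w).space k ↔ ∀ j : Fin n, (k : ℕ) ≤ j → v (w j) = 0 := by
  constructor
  · intro hv j hj
    induction hv using Submodule.span_induction with
    | mem v hv =>
      obtain ⟨m, hm, rfl⟩ := hv
      have : w j ≠ w m := w.injective.ne (by rintro rfl; exact absurd hm (not_lt.2 hj))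
      exact Pi.single_eq_of_ne this _
    | zero => rfl
    | add x y _ _ hx hy => rw [Pi.add_apply, hx, hy, add_zero]
    | smul c x _ hx => rw [Pi.smul_apply, hx, smul_zero]
  · intro h
    rw [pi_eq_sum_univ' v, ← Equiv.sum_comp w]
    refine Submodule.sum_mem _ fun j _ => ?_
    by_cases hj : (k : ℕ) ≤ j
    · rw [h j hj, zero_smul]; exact Submodule.zero_mem _
    · refine Submodule.smul_mem _ _ (Submodule.subset_span ⟨j, not_le.1 hj, ?_⟩)
      ext m
      simp [Pi.single_apply]

theorem CompleteFlag.space_eq_of_le {F G : CompleteFlag K n} {k : Fin (n + 1)}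
    (h : F.space k ≤ G.space k) : F.space k = G.space k :=
  Submodule.eq_of_le_of_finrank_eq h (by rw [F.finrank_space, G.finrank_space])

theorem toLin'_injective (b : Matrix.GeneralLinearGroup (Fin n) K) :
    Function.Injective (Matrix.toLin' (b : Matrix (Fin n) (Fin n) K)) := by
  refine Function.LeftInverse.injective (g := Matrix.toLin' (b⁻¹ : Matrix.GeneralLinearGroup _ K).1)
    fun v => ?_
  rw [← LinearMap.comp_apply, ← Matrix.toLin'_mul]
  simp

/-- The action of an invertible matrix on a flag. -/
def flagMap (b : Matrix.GeneralLinearGroup (Fin n) K) (F : CompleteFlag K n) :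
    CompleteFlag K n where
  space k := (F.space k).map (Matrix.toLin' (b : Matrix (Fin n) (Fin n) K))
  mono _ _ h := Submodule.map_mono (F.mono h)
  finrank_space k := by
    rw [(Submodule.equivMapOfInjective _ (toLin'_injective b) _).symm.finrank_eq, F.finrank_space]

theorem flagMap_mul (b c : Matrix.GeneralLinearGroup (Fin n) K) (F : CompleteFlag K n) :
    flagMap (b * c) F = flagMap b (flagMap c F) := by
  ext1
  funext k
  simp [flagMap, Matrix.toLin'_mul, Submodule.map_comp]

theorem flagMap_one (F : CompleteFlag K n) : flagMap 1 F = F := by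
  ext1
  funext k
  simp [flagMap]

/-- The permutation of the flags by an invertible matrix. -/
def flagEquiv (b : Matrix.GeneralLinearGroup (Fin n) K) : CompleteFlag K n ≃ CompleteFlag K n where
  toFun := flagMap b
  invFun := flagMap b⁻¹
  left_inv F := by rw [← flagMap_mul, inv_mul_cancel, flagMap_one]
  right_inv F := by rw [← flagMap_mul, mul_inv_cancel, flagMap_one]

/-! ### The Borel subgroup and the disjointness of Schubert cells. -/

variable (K n) in
/-- The group of invertible upper triangular matrices. -/
def borel : Subgroup (Matrix.GeneralLinearGroup (Fin n) K) where
  carrier := {b | (b : Matrix (Fin n) (Fin n) K).BlockTriangular id}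
  one_mem' := Matrix.blockTriangular_one
  mul_mem' := Matrix.BlockTriangular.mul
  inv_mem' {b} hb := by
    have := Matrix.blockTriangular_inv_of_blockTriangular (M := b.1) hb
    simpa using this

theorem mem_borel {b : Matrix.GeneralLinearGroup (Fin n) K} :
    b ∈ borel n K ↔ ∀ i j, j < i → (b : Matrix (Fin n) (Fin n) K) i j = 0 := Iff.rfl

theorem mem_schubertCell {w : Equiv.Perm (Fin n)} {F : CompleteFlag K n} :
    F ∈ schubertCell K w ↔ ∃ b ∈ borel n K, F = flagMap b (coordFlag K w) := by
  simp only [schubertCell, Set.mem_ofPred_eq, mem_borel, CompleteFlag.ext_iff, funext_iff]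
  rfl

theorem coordFlag_mem_schubertCell (w : Equiv.Perm (Fin n)) :
    coordFlag K w ∈ schubertCell K w :=
  mem_schubertCell.2 ⟨1, one_mem _, (flagMap_one _).symm⟩

theorem flagMap_mem_schubertCell {b : Matrix.GeneralLinearGroup (Fin n) K} (hb : b ∈ borel n K)
    {w : Equiv.Perm (Fin n)} {F : CompleteFlag K n} :
    flagMap b F ∈ schubertCell K w ↔ F ∈ schubertCell K w := by
  simp only [mem_schubertCell]
  constructor
  · rintro ⟨c, hc, h⟩
    refine ⟨b⁻¹ * c, mul_mem (inv_mem hb) hc, ?_⟩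
    rw [flagMap_mul, ← h, ← flagMap_mul, inv_mul_cancel, flagMap_one]
  · rintro ⟨c, hc, rfl⟩
    exact ⟨b * c, mul_mem hb hc, (flagMap_mul _ _ _).symm⟩

theorem perm_eq_one_of_le {σ : Equiv.Perm (Fin n)} (h : ∀ j, σ j ≤ j) : σ = 1 := by
  ext j
  induction j using WellFoundedLT.induction with
  | _ j ih =>
    rcases (h j).lt_or_eq with hj | hj
    · exact congrArg Fin.val (σ.injective (Fin.ext (ih _ hj)))
    · exact congrArg Fin.val hj

theorem borel_diag_ne_zero {b : Matrix.GeneralLinearGroup (Fin n) K} (hb : b ∈ borel n K)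
    (i : Fin n) : (b : Matrix (Fin n) (Fin n) K) i i ≠ 0 := by
  have h := Matrix.det_of_isUpperTriangular (M := (b : Matrix (Fin n) (Fin n) K)) hb
  have h0 : (b : Matrix (Fin n) (Fin n) K).det ≠ 0 :=
    ((Matrix.isUnit_iff_isUnit_det _).1 b.isUnit).ne_zero
  rw [h, Finset.prod_ne_zero_iff] at h0
  exact h0 i (Finset.mem_univ i)

/-- If an upper triangular `b` carries `E^w` to `E^{w'}`, then `b e_{w(j)}` has a nonzero coordinate
at `w(j)`, by the diagonal of `b`. As it lies in the first `j + 1` dimensions of `E^{w'}`, this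
forces `w'⁻¹ w (j) ≤ j` for all `j`, so `w'⁻¹ w = 1`. -/
theorem schubertCell_disjoint {w w' : Equiv.Perm (Fin n)} {F : CompleteFlag K n}
    (h : F ∈ schubertCell K w) (h' : F ∈ schubertCell K w') : w = w' := by
  obtain ⟨c, hc, rfl⟩ := mem_schubertCell.1 h'
  rw [flagMap_mem_schubertCell hc] at h
  obtain ⟨b, hb, hbw⟩ := mem_schubertCell.1 h
  have key : w'⁻¹ * w = 1 := by
    refine perm_eq_one_of_le fun j => ?_
    have h1 : (Pi.single (w j) 1 : Fin n → K) ∈ (coordFlag K w).space j.succ := by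
      rw [mem_coordFlag]
      intro m hm
      refine Pi.single_eq_of_ne (w.injective.ne ?_) _
      rintro rfl
      simp at hm
    have h2 : Matrix.toLin' (b : Matrix (Fin n) (Fin n) K) (Pi.single (w j) 1) ∈
        (coordFlag K w').space j.succ := by
      rw [hbw]
      exact Submodule.mem_map_of_mem h1
    rw [mem_coordFlag] at h2
    by_contra hlt
    have h3 := h2 ((w'⁻¹ * w) j) (by rw [Fin.val_succ]; exact not_le.1 hlt)
    rw [← Equiv.Perm.mul_apply, mul_inv_cancel_left, Matrix.toLin'_apply,
      Matrix.mulVec_single_one] at h3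
    exact borel_diag_ne_zero hb _ h3
  exact (inv_mul_eq_one.1 key).symm

/-! ### Neighbouring flags -/

/-- Two flags agree except possibly in dimension `i + 1`. -/
def Adjacent (i : Fin (n - 1)) (F G : CompleteFlag K n) : Prop :=
  ∀ k : Fin (n + 1), (k : ℕ) ≠ (i : ℕ) + 1 → F.space k = G.space k

theorem Adjacent.symm {i : Fin (n - 1)} {F G : CompleteFlag K n} (h : Adjacent i F G) :
    Adjacent i G F := fun k hk => (h k hk).symm

theorem Adjacent.trans {i : Fin (n - 1)} {F G H : CompleteFlag K n} (h : Adjacent i F G)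
    (h' : Adjacent i G H) : Adjacent i F H := fun k hk => (h k hk).trans (h' k hk)

theorem adjacent_refl (i : Fin (n - 1)) (F : CompleteFlag K n) : Adjacent i F F := fun _ _ => rfl

theorem adjacent_flagMap {i : Fin (n - 1)} {F G : CompleteFlag K n}
    (b : Matrix.GeneralLinearGroup (Fin n) K) :
    Adjacent i (flagMap b F) (flagMap b G) ↔ Adjacent i F G :=
  forall₂_congr fun _ _ => (Submodule.map_injective_of_injective (toLin'_injective b)).eq_iff

/-- The dimension `i + 1` in which adjacent flags differ. -/
def mid (i : Fin (n - 1)) : Fin (n + 1) := ⟨i + 1, by omega⟩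

theorem Adjacent.ext {i : Fin (n - 1)} {F G : CompleteFlag K n} (h : Adjacent i F G)
    (h' : F.space (mid i) = G.space (mid i)) : F = G := by
  ext1
  funext k
  by_cases hk : (k : ℕ) = i + 1
  · obtain rfl : k = mid i := Fin.ext hk
    exact h'
  · exact h k hk

theorem le_simple_iff {i : Fin (n - 1)} {k : ℕ} (hk : k ≠ (i : ℕ) + 1) (j : Fin n) :
    k ≤ simple i j ↔ k ≤ j := by
  by_cases h1 : j = lo i
  · rw [h1, simple_lo]; simp only [lo, hi]; omega
  by_cases h2 : j = hi i
  · rw [h2, simple_hi]; simp only [lo, hi]; omega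
  rw [simple_of_ne h1 h2]

theorem adjacent_coordFlag (i : Fin (n - 1)) (w : Equiv.Perm (Fin n)) :
    Adjacent i (coordFlag K w) (coordFlag K (w * simple i)) := by
  intro k hk
  ext v
  rw [mem_coordFlag, mem_coordFlag, ← (simple i).forall_congr_right]
  simp only [le_simple_iff hk, Equiv.Perm.mul_apply]

/-- The elementary matrix adding `t` times the coordinate `w (hi i)` to the coordinate
`w (lo i)`. -/
def elem (w : Equiv.Perm (Fin n)) (i : Fin (n - 1)) (t : K) :
    Matrix.GeneralLinearGroup (Fin n) K :=
  Matrix.GeneralLinearGroup.mkOfDetNeZero (Matrix.transvection (w (lo i)) (w (hi i)) t) (by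
    rw [Matrix.det_transvection_of_ne _ _ (w.injective.ne (lo_ne_hi i))]
    exact one_ne_zero)

theorem elem_apply (w : Equiv.Perm (Fin n)) (i : Fin (n - 1)) (t : K) (v : Fin n → K) :
    Matrix.toLin' (elem w i t : Matrix (Fin n) (Fin n) K) v =
      v + Pi.single (w (lo i)) (t * v (w (hi i))) := by
  rw [Matrix.toLin'_apply]
  change (Matrix.transvection (w (lo i)) (w (hi i)) t).mulVec v = _
  rw [Matrix.transvection, Matrix.add_mulVec, Matrix.one_mulVec, Matrix.single_mulVec]
  rfl

theorem elem_mem_borel {w : Equiv.Perm (Fin n)} {i : Fin (n - 1)} (h : Up w i) (t : K) :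
    elem w i t ∈ borel n K := by
  rw [mem_borel]
  intro a b hab
  change Matrix.transvection (w (lo i)) (w (hi i)) t a b = 0
  rw [Matrix.transvection, Matrix.add_apply, Matrix.one_apply_ne (ne_of_gt hab), zero_add,
    Matrix.single_apply_of_ne]
  rintro ⟨rfl, rfl⟩
  exact absurd h (not_lt.2 (le_of_lt hab))

/-- The matrix adds a multiple of `e_{w(lo i)}` to `e_{w(hi i)}`, and the former vector enters the
flag first. No ascent is needed here, only for membership in the Borel subgroup. -/
theorem flagMap_elem_coordFlag (w : Equiv.Perm (Fin n)) (i : Fin (n - 1)) (t : K) :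
    flagMap (elem w i t) (coordFlag K w) = coordFlag K w := by
  ext1
  funext k
  refine CompleteFlag.space_eq_of_le ?_
  rintro _ ⟨v, hv, rfl⟩
  rw [SetLike.mem_coe, mem_coordFlag] at hv
  rw [mem_coordFlag]
  intro j hj
  rw [elem_apply, Pi.add_apply, hv j hj, zero_add]
  by_cases h : j = lo i
  · subst h
    rw [hv (hi i) (hj.trans (lo_lt_hi i).le), mul_zero, Pi.single_zero, Pi.zero_apply]
  · exact Pi.single_eq_of_ne (w.injective.ne h) _

/-- The neighbours of the coordinate flag of `w`, other than itself. -/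
def neighbour (w : Equiv.Perm (Fin n)) (i : Fin (n - 1)) (t : K) : CompleteFlag K n :=
  flagMap (elem w i t) (coordFlag K (w * simple i))

theorem adjacent_neighbour (w : Equiv.Perm (Fin n)) (i : Fin (n - 1)) (t : K) :
    Adjacent i (coordFlag K w) (neighbour w i t) := by
  have := (adjacent_flagMap (elem w i t)).2 (adjacent_coordFlag (K := K) i w)
  rwa [flagMap_elem_coordFlag] at this

theorem neighbour_mem {w : Equiv.Perm (Fin n)} {i : Fin (n - 1)} (h : Up w i) (t : K) :
    neighbour w i t ∈ schubertCell K (w * simple i) :=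
  (flagMap_mem_schubertCell (elem_mem_borel h t)).2 (coordFlag_mem_schubertCell _)

theorem neighbour_injective (w : Equiv.Perm (Fin n)) (i : Fin (n - 1)) :
    Function.Injective (neighbour (K := K) w i) := by
  intro t t' h
  have hne : w (hi i) ≠ w (lo i) := w.injective.ne (lo_ne_hi i).symm
  have h1 : (Pi.single (w (hi i)) 1 : Fin n → K) ∈
      (coordFlag K (w * simple i)).space (mid i) := by
    rw [mem_coordFlag]
    intro j hj
    refine Pi.single_eq_of_ne (w.injective.ne ?_) _
    intro hj'
    rw [← simple_lo, (simple i).injective.eq_iff] at hj'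
    rw [hj'] at hj
    simp [mid, lo] at hj
  have h2 : Matrix.toLin' (elem w i t : Matrix (Fin n) (Fin n) K) (Pi.single (w (hi i)) 1) ∈
      (neighbour w i t').space (mid i) := h ▸ Submodule.mem_map_of_mem h1
  obtain ⟨v, hv, he⟩ := h2
  rw [SetLike.mem_coe, mem_coordFlag] at hv
  have hv := hv (hi i) le_rfl
  rw [Equiv.Perm.mul_apply, simple_hi] at hv
  rw [elem_apply, elem_apply] at he
  have e1 := congrFun he (w (hi i))
  have e2 := congrFun he (w (lo i))
  simp only [Pi.add_apply, Pi.single_eq_same, Pi.single_eq_of_ne hne, Pi.single_eq_of_ne hne.symm,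
    add_zero, hv, zero_add, mul_one] at e1 e2
  rw [e1, mul_one] at e2
  exact e2.symm

/-- Modulo the space of dimension `i`, the space of dimension `i + 2` is the plane spanned by
`e_{w(lo i)}` and `e_{w(hi i)}`. -/
theorem sub_mem_coordFlag {w : Equiv.Perm (Fin n)} {i : Fin (n - 1)} {v : Fin n → K}
    {k k' : Fin (n + 1)} (hk : (k : ℕ) = i) (hk' : (k' : ℕ) = i + 2)
    (hv : v ∈ (coordFlag K w).space k') :
    v - v (w (lo i)) • Pi.single (w (lo i)) 1 - v (w (hi i)) • Pi.single (w (hi i)) 1 ∈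
      (coordFlag K w).space k := by
  have hne : w (hi i) ≠ w (lo i) := w.injective.ne (lo_ne_hi i).symm
  rw [mem_coordFlag] at *
  intro j hj
  simp only [Pi.sub_apply, Pi.smul_apply, smul_eq_mul]
  by_cases h1 : j = lo i
  · subst h1; simp [Pi.single_eq_of_ne hne.symm]
  by_cases h2 : j = hi i
  · subst h2; simp [Pi.single_eq_of_ne hne]
  rw [hv j (by simp only [lo, hi, Fin.ext_iff] at h1 h2; omega),
    Pi.single_eq_of_ne (w.injective.ne h1), Pi.single_eq_of_ne (w.injective.ne h2)]
  simp

/-- An adjacent flag is a line in that plane: either the line of `e_{w(lo i)}`, or the line of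
`e_{w(hi i)} + t e_{w(lo i)}` for some `t`. -/
theorem eq_or_eq_neighbour_of_adjacent {w : Equiv.Perm (Fin n)} {i : Fin (n - 1)}
    {G : CompleteFlag K n} (h : Adjacent i (coordFlag K w) G) :
    G = coordFlag K w ∨ ∃ t, G = neighbour w i t := by
  obtain ⟨k, hk⟩ : ∃ k : Fin (n + 1), (k : ℕ) = i := ⟨⟨i, by omega⟩, rfl⟩
  obtain ⟨k', hk'⟩ : ∃ k : Fin (n + 1), (k : ℕ) = i + 2 := ⟨⟨i + 2, by omega⟩, rfl⟩
  have hm : ((mid i : Fin (n + 1)) : ℕ) = i + 1 := rfl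
  have hlow : (coordFlag K w).space k ≤ G.space (mid i) := by
    rw [h k (by omega)]
    exact G.mono (Fin.le_def.2 (by omega))
  have hhigh : G.space (mid i) ≤ (coordFlag K w).space k' := by
    rw [h k' (by omega)]
    exact G.mono (Fin.le_def.2 (by omega))
  by_cases hlo : (Pi.single (w (lo i)) 1 : Fin n → K) ∈ G.space (mid i)
  · left
    refine (h.ext (CompleteFlag.space_eq_of_le ?_)).symm
    intro v hv
    have h0 : v (w (hi i)) = 0 := mem_coordFlag.1 hv (hi i) le_rfl
    have h1 := sub_mem_coordFlag hk hk' ((coordFlag K w).mono (Fin.le_def.2 (by omega)) hv)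
    rw [h0, zero_smul, sub_zero] at h1
    simpa using Submodule.add_mem _ (hlow h1) (Submodule.smul_mem _ (v (w (lo i))) hlo)
  · right
    obtain ⟨v, hv, hv'⟩ : ∃ v ∈ G.space (mid i), v ∉ (coordFlag K w).space k := by
      by_contra! hle
      have := Submodule.finrank_mono (show G.space (mid i) ≤ (coordFlag K w).space k from hle)
      rw [G.finrank_space, CompleteFlag.finrank_space] at this
      omega
    set α := v (w (lo i)) with hα
    set β := v (w (hi i)) with hβ
    have h1 := sub_mem_coordFlag hk hk' (hhigh hv)
    rw [← hα, ← hβ] at h1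
    have hβ0 : β ≠ 0 := by
      intro h0
      rw [h0, zero_smul, sub_zero] at h1
      by_cases hα0 : α = 0
      · rw [hα0, zero_smul, sub_zero] at h1
        exact hv' h1
      · have h2 := Submodule.sub_mem _ hv (hlow h1)
        rw [sub_sub_cancel] at h2
        exact hlo ((Submodule.smul_mem_iff _ hα0).1 h2)
    -- Scaling the line's generator so that its coefficient of `e_{w(hi i)}` is `1` gives the
    -- parameter `t = α / β`.
    have h2 : (Pi.single (w (hi i)) 1 + (α / β) • Pi.single (w (lo i)) 1 : Fin n → K) ∈
        G.space (mid i) := by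
      have h3 := Submodule.smul_mem _ β⁻¹ (Submodule.sub_mem _ hv (hlow h1))
      convert h3 using 1
      rw [sub_sub, sub_sub_cancel, smul_add, smul_smul, smul_smul, inv_mul_cancel₀ hβ0, one_smul,
        div_eq_inv_mul, add_comm]
    refine ⟨α / β, ((h.symm.trans (adjacent_neighbour w i _)).symm.ext
      (CompleteFlag.space_eq_of_le ?_)).symm⟩
    rintro _ ⟨u, hu, rfl⟩
    have h4 : u (w (lo i)) = 0 := by
      simpa using mem_coordFlag.1 hu (hi i) le_rfl
    have h5 : u ∈ (coordFlag K w).space k' := by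
      rw [adjacent_coordFlag i w k' (by omega)]
      exact (coordFlag K _).mono (Fin.le_def.2 (by omega)) hu
    have h6 := sub_mem_coordFlag hk hk' h5
    rw [h4, zero_smul, sub_zero] at h6
    have h7 := Submodule.add_mem _ (hlow h6) (Submodule.smul_mem _ (u (w (hi i))) h2)
    rw [elem_apply]
    convert h7 using 1
    rw [smul_add, ← add_assoc, sub_add_cancel, smul_smul, ← Pi.single_smul, smul_eq_mul, mul_one,
      mul_comm]

end Flags

/-! ### Counting points -/

section Count

variable {K : Type} [Field K]

theorem mem_cell_of_adjacent_coordFlag {w : Equiv.Perm (Fin n)} {i : Fin (n - 1)} (h : Up w i)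
    {G : CompleteFlag K n} (hG : Adjacent i (coordFlag K w) G) :
    G ∈ schubertCell K w ∨ G ∈ schubertCell K (w * simple i) := by
  obtain rfl | ⟨t, rfl⟩ := eq_or_eq_neighbour_of_adjacent hG
  · exact Or.inl (coordFlag_mem_schubertCell w)
  · exact Or.inr (neighbour_mem h t)

theorem card_adjacent_coordFlag_self {w : Equiv.Perm (Fin n)} {i : Fin (n - 1)} (h : Up w i) :
    Nat.card {G // Adjacent i (coordFlag K w) G ∧ G ∈ schubertCell K w} = 1 := by
  rw [Nat.card_eq_one_iff_unique]
  refine ⟨⟨fun ⟨G, hG, hGw⟩ ⟨G', hG', hGw'⟩ => ?_⟩,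
    ⟨⟨coordFlag K w, adjacent_refl _ _, coordFlag_mem_schubertCell w⟩⟩⟩
  have key : ∀ G, Adjacent i (coordFlag K w) G → G ∈ schubertCell K w → G = coordFlag K w := by
    intro G hG hGw
    obtain hG | ⟨t, rfl⟩ := eq_or_eq_neighbour_of_adjacent hG
    · exact hG
    · exact absurd (schubertCell_disjoint (neighbour_mem h t) hGw) (mul_simple_ne w i)
  exact Subtype.ext ((key G hG hGw).trans (key G' hG' hGw').symm)

theorem card_adjacent_coordFlag_mul_simple {w : Equiv.Perm (Fin n)} {i : Fin (n - 1)}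
    (h : Up w i) : Nat.card {G // Adjacent i (coordFlag K w) G ∧
      G ∈ schubertCell K (w * simple i)} = Nat.card K := by
  refine (Nat.card_congr (Equiv.ofBijective
    (fun t => ⟨neighbour w i t, adjacent_neighbour w i t, neighbour_mem h t⟩) ⟨?_, ?_⟩)).symm
  · intro t t' ht
    exact neighbour_injective w i (congrArg Subtype.val ht)
  · rintro ⟨G, hG, hGw⟩
    obtain rfl | ⟨t, rfl⟩ := eq_or_eq_neighbour_of_adjacent hG
    · exact absurd (schubertCell_disjoint hGw (coordFlag_mem_schubertCell w)) (mul_simple_ne w i)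
    · exact ⟨t, rfl⟩

/-- Reduces every count to the neighbours of a coordinate flag at an ascent: translate by the Borel
subgroup and, at a descent, pass to the adjacent flag of `w s_i`. Adjacency is an equivalence
relation, so the set of neighbours does not change. -/
theorem exists_adjacent_coordFlag {w : Equiv.Perm (Fin n)} {F : CompleteFlag K n}
    (hF : F ∈ schubertCell K w) (i : Fin (n - 1)) :
    ∃ b ∈ borel n K, ∃ a, Up a i ∧ (w = a ∨ w = a * simple i) ∧
      Adjacent i F (flagMap b (coordFlag K a)) := by
  obtain ⟨b, hb, rfl⟩ := mem_schubertCell.1 hF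
  by_cases h : Up w i
  · exact ⟨b, hb, w, h, Or.inl rfl, adjacent_refl _ _⟩
  · exact ⟨b, hb, w * simple i, up_mul_simple.2 h, Or.inr (by simp),
      (adjacent_flagMap b).2 (adjacent_coordFlag i w)⟩

theorem mem_cell_of_adjacent {w : Equiv.Perm (Fin n)} {i : Fin (n - 1)} {F G : CompleteFlag K n}
    (hF : F ∈ schubertCell K w) (hG : Adjacent i F G) :
    G ∈ schubertCell K w ∨ G ∈ schubertCell K (w * simple i) := by
  obtain ⟨b, hb, a, ha, hw, hFa⟩ := exists_adjacent_coordFlag hF i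
  obtain ⟨G, rfl⟩ := (flagEquiv b).surjective G
  have h := mem_cell_of_adjacent_coordFlag ha ((adjacent_flagMap b).1 (hFa.symm.trans hG))
  change flagMap b G ∈ _ ∨ flagMap b G ∈ _
  rw [flagMap_mem_schubertCell hb, flagMap_mem_schubertCell hb]
  rcases hw with rfl | rfl
  · exact h
  · rw [mul_simple_mul_simple]; exact h.symm

theorem card_adjacent {x w : Equiv.Perm (Fin n)} {i : Fin (n - 1)} {F : CompleteFlag K n}
    (hF : F ∈ schubertCell K x) (hx : x = w ∨ x = w * simple i) :
    Nat.card {G // Adjacent i F G ∧ G ∈ schubertCell K w} = stepFactor (Nat.card K) w i := by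
  obtain ⟨b, hb, a, ha, hw, hFa⟩ := exists_adjacent_coordFlag hF i
  have e : {G // Adjacent i (coordFlag K a) G ∧ G ∈ schubertCell K w} ≃
      {G // Adjacent i F G ∧ G ∈ schubertCell K w} :=
    (flagEquiv b).subtypeEquiv fun G => by
      change _ ↔ Adjacent i F (flagMap b G) ∧ flagMap b G ∈ _
      rw [flagMap_mem_schubertCell hb, ← adjacent_flagMap b]
      exact and_congr_left fun _ => ⟨hFa.trans, hFa.symm.trans⟩
  rw [← Nat.card_congr e]
  have hwa : w = a ∨ w = a * simple i := by
    rcases hx with rfl | rfl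
    · exact hw
    · rw [mul_simple_eq_iff, mul_simple_eq_iff, mul_simple_mul_simple] at hw
      exact hw.symm
  rcases hwa with rfl | rfl
  · rw [card_adjacent_coordFlag_self ha, stepFactor, if_pos ha]
  · rw [card_adjacent_coordFlag_mul_simple ha, stepFactor, if_neg]
    rwa [up_mul_simple, not_not]

theorem card_adjacent_eq_zero {w : Equiv.Perm (Fin n)} {i : Fin (n - 1)} {F : CompleteFlag K n}
    (h : F ∉ schubertCell K w) (h' : F ∉ schubertCell K (w * simple i)) :
    Nat.card {G // Adjacent i F G ∧ G ∈ schubertCell K w} = 0 := by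
  have : IsEmpty {G // Adjacent i F G ∧ G ∈ schubertCell K w} :=
    ⟨fun ⟨G, hG, hGw⟩ => (mem_cell_of_adjacent hGw hG.symm).elim h h'⟩
  exact Nat.card_of_isEmpty

open scoped Classical in
-- The cells are disjoint, so at most one of the two indicators is nonzero.
theorem card_adjacent_eq (w : Equiv.Perm (Fin n)) (i : Fin (n - 1)) (F : CompleteFlag K n) :
    Nat.card {G // Adjacent i F G ∧ G ∈ schubertCell K w} =
      ((if F ∈ schubertCell K w then 1 else 0) +
        (if F ∈ schubertCell K (w * simple i) then 1 else 0)) * stepFactor (Nat.card K) w i := by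
  by_cases h : F ∈ schubertCell K w
  · have h' : F ∉ schubertCell K (w * simple i) :=
      fun h' => mul_simple_ne w i (schubertCell_disjoint h' h)
    rw [card_adjacent h (Or.inl rfl), if_pos h, if_neg h', add_zero, one_mul]
  · by_cases h' : F ∈ schubertCell K (w * simple i)
    · rw [card_adjacent h' (Or.inr rfl), if_neg h, if_pos h', zero_add, one_mul]
    · rw [card_adjacent_eq_zero h h', if_neg h, if_neg h', add_zero, zero_mul]

/-- A point of the Bott–Samelson variety over a Schubert cell is a point for the word without its
last letter, together with a flag of the cell adjacent to its last flag. -/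
def preimageEquiv {L : ℕ} (R : Fin (L + 1) → Fin (n - 1)) (w : Equiv.Perm (Fin n)) :
    proj K R ⁻¹' schubertCell K w ≃ {P : Variety K (Fin.init R) × CompleteFlag K n //
      Adjacent (R (Fin.last L)) (proj K (Fin.init R) P.1) P.2 ∧ P.2 ∈ schubertCell K w} where
  toFun F := ⟨⟨⟨fun r => F.1.1 r.castSucc, F.1.2.1, fun r k hk => F.1.2.2 r.castSucc k hk⟩,
    F.1.1 (Fin.last _)⟩, fun k hk => F.1.2.2 (Fin.last L) k hk, F.2⟩
  invFun P := ⟨⟨Fin.snoc (α := fun _ => CompleteFlag K n) P.1.1.1 P.1.2, by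
    obtain ⟨⟨⟨G, h0, hG⟩, H⟩, hH, -⟩ := P
    refine ⟨?_, fun r k hk => ?_⟩
    · exact (Fin.snoc_castSucc (α := fun _ => CompleteFlag K n) H G 0).trans h0
    · induction r using Fin.lastCases with
      | last =>
        rw [Fin.succ_last, Fin.snoc_last, Fin.snoc_castSucc]
        exact hH k hk
      | cast r =>
        rw [Fin.succ_castSucc, Fin.snoc_castSucc, Fin.snoc_castSucc]
        exact hG r k hk⟩, by
    change Fin.snoc (α := fun _ => CompleteFlag K n) P.1.1.1 P.1.2 (Fin.last _) ∈ schubertCell K w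
    rw [Fin.snoc_last]
    exact P.2.2⟩
  left_inv F := Subtype.ext (Subtype.ext
    (Fin.snoc_init_self (α := fun _ => CompleteFlag K n) F.1.1))
  right_inv P := Subtype.ext (Prod.ext (Subtype.ext (funext fun r =>
    Fin.snoc_castSucc (α := fun _ => CompleteFlag K n) P.1.2 P.1.1.1 r))
    (Fin.snoc_last (α := fun _ => CompleteFlag K n) P.1.2 P.1.1.1))

variable [Finite K]

instance : Finite (CompleteFlag K n) :=
  Finite.of_injective CompleteFlag.space fun _ _ => CompleteFlag.ext

instance {L : ℕ} (R : Fin L → Fin (n - 1)) : Finite (Variety K R) :=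
  inferInstanceAs (Finite (Subtype _))

/-- Geometric counterpart of `wt_succ`: fibre the points over those of the truncated word and count
the admissible last flags in each fibre. -/
theorem card_preimage_succ {L : ℕ} (R : Fin (L + 1) → Fin (n - 1)) (w : Equiv.Perm (Fin n)) :
    Nat.card (proj K R ⁻¹' schubertCell K w) =
      (Nat.card (proj K (Fin.init R) ⁻¹' schubertCell K w) +
        Nat.card (proj K (Fin.init R) ⁻¹' schubertCell K (w * simple (R (Fin.last L))))) *
      stepFactor (Nat.card K) w (R (Fin.last L)) := by
  classical
  have := Fintype.ofFinite (Variety K (Fin.init R))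
  have hc : ∀ x, Nat.card (proj K (Fin.init R) ⁻¹' schubertCell K x) =
      ∑ G, if proj K (Fin.init R) G ∈ schubertCell K x then 1 else 0 := by
    intro x
    rw [Nat.card_eq_fintype_card, Finset.sum_boole, Nat.cast_id, ← Fintype.card_subtype]
    rfl
  rw [Nat.card_congr ((preimageEquiv R w).trans (Equiv.subtypeProdEquivSigmaSubtype
      fun (G : Variety K (Fin.init R)) H => Adjacent (R (Fin.last L)) (proj K (Fin.init R) G) H ∧
        H ∈ schubertCell K w)),
    Nat.card_sigma, hc, hc, ← Finset.sum_add_distrib,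
    Finset.sum_mul]
  exact Finset.sum_congr rfl fun G _ => card_adjacent_eq _ _ _

/-- The number of points over a Schubert cell is the value of the weight. -/
theorem card_preimage {L : ℕ} (R : Fin L → Fin (n - 1)) (w : Equiv.Perm (Fin n)) :
    (Nat.card (proj K R ⁻¹' schubertCell K w) : ℤ) = (wt R w).eval (Nat.card K : ℤ) := by
  induction L generalizing w with
  | zero =>
    have hp : ∀ F : Variety K R, proj K R F = coordFlag K 1 := fun F => F.2.1
    rw [wt_zero]
    split_ifs with h
    · subst h
      rw [Polynomial.eval_one, Nat.cast_eq_one, Nat.card_eq_one_iff_unique]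
      refine ⟨⟨fun F G => Subtype.ext (Subtype.ext (funext fun r => ?_))⟩,
        ⟨⟨⟨fun _ => coordFlag K 1, rfl, fun r => r.elim0⟩, coordFlag_mem_schubertCell 1⟩⟩⟩
      rw [Fin.fin_one_eq_zero r]
      exact F.1.2.1.trans G.1.2.1.symm
    · have : IsEmpty (proj K R ⁻¹' schubertCell K w) := ⟨fun ⟨F, hF⟩ => h
        (schubertCell_disjoint hF ((hp F).symm ▸ coordFlag_mem_schubertCell 1))⟩
      simp
  | succ L ih =>
    have hs : ((stepFactor (Nat.card K) w (R (Fin.last L)) : ℕ) : ℤ) =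
        (stepFactor Polynomial.X w (R (Fin.last L)) : ℤ[X]).eval (Nat.card K : ℤ) := by
      unfold stepFactor
      split_ifs <;> simp
    rw [card_preimage_succ, wt_succ, Polynomial.eval_mul, Polynomial.eval_add, ← ih, ← ih, ← hs]
    push_cast
    rfl

theorem distribution_eq {L : ℕ} (R : Fin L → Fin (n - 1)) (w : Equiv.Perm (Fin n)) :
    distribution K R w = ((wt R w).map (Int.castRingHom ℚ)).eval (Nat.card K : ℚ) /
      ((Nat.card K : ℚ) + 1) ^ L := by
  have h := card_preimage (K := K) R w
  have h1 := Polynomial.eval_map_apply (Int.castRingHom ℚ) (p := wt R w) (Nat.card K : ℤ)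
  rw [← h] at h1
  simp only [Int.cast_natCast, eq_intCast] at h1
  rw [distribution, h1]

end Count

/-! ### The main equivalences -/

theorem isRationalForm_wt {L : ℕ} (R : Fin L → Fin (n - 1)) (w : Equiv.Perm (Fin n)) :
    IsRationalForm R w (algebraMap ℚ[X] (RatFunc ℚ) ((wt R w).map (Int.castRingHom ℚ)) /
      algebraMap ℚ[X] (RatFunc ℚ) ((Polynomial.X + 1) ^ L)) := by
  intro K _ _
  have h0 : ((Polynomial.X + 1 : ℚ[X]) ^ L).eval (Nat.card K : ℚ) ≠ 0 := by
    simp only [Polynomial.eval_pow, Polynomial.eval_add, Polynomial.eval_X, Polynomial.eval_one]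
    positivity
  set p := (wt R w).map (Int.castRingHom ℚ) with hp
  set r := (Polynomial.X + 1 : ℚ[X]) ^ L with hr
  have hr0 : r ≠ 0 := by rintro h; simp [h] at h0
  -- The fraction need not be in lowest terms, but its reduced denominator divides `(X + 1) ^ L`,
  -- which does not vanish at `q`.
  have hd : (algebraMap ℚ[X] (RatFunc ℚ) p / algebraMap ℚ[X] (RatFunc ℚ) r).denom.eval
      (Nat.card K : ℚ) ≠ 0 := fun h =>
    h0 (Polynomial.eval_eq_zero_of_dvd_of_eval_eq_zero (RatFunc.denom_div_dvd p r) h)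
  refine ⟨hd, ?_⟩
  have h1 := congrArg (Polynomial.eval (Nat.card K : ℚ))
    ((RatFunc.num_mul_eq_mul_denom_iff (p := p) hr0).2 rfl)
  rw [Polynomial.eval_mul, Polynomial.eval_mul] at h1
  have h2 : r.eval (Nat.card K : ℚ) = ((Nat.card K : ℚ) + 1) ^ L := by simp [hr]
  rw [distribution_eq, ← h2, RatFunc.eval, Polynomial.eval₂_id, Polynomial.eval₂_id,
    div_eq_div_iff hd h0, h1]

/-- Prime fields already suffice: the common length cancels the denominators, and polynomials that
agree at infinitely many primes are equal. -/
theorem wt_eq_of_distribution_eq {L : ℕ} {R R' : Fin L → Fin (n - 1)}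
    (h : ∀ (K : Type) [Field K] [Finite K] (w : Equiv.Perm (Fin n)),
      distribution K R w = distribution K R' w) (w : Equiv.Perm (Fin n)) : wt R w = wt R' w := by
  apply Polynomial.map_injective (Int.castRingHom ℚ) Int.cast_injective
  apply Polynomial.eq_of_infinite_eval_eq
  refine Set.Infinite.mono ?_ (Nat.infinite_setOfPred_prime.image
    (Nat.cast_injective (R := ℚ)).injOn)
  rintro _ ⟨p, hp, rfl⟩
  have : Fact p.Prime := ⟨hp⟩
  have h1 := h (ZMod p) w
  rw [distribution_eq, distribution_eq, Nat.card_zmod] at h1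
  exact (div_left_inj' (by positivity)).1 h1

theorem Equivalent.distribution_eq {L L' : ℕ} {R : Fin L → Fin (n - 1)} {R' : Fin L' → Fin (n - 1)}
    (h : Equivalent R R') (K : Type) [Field K] [Finite K] (w : Equiv.Perm (Fin n)) :
    distribution K R w = distribution K R' w := by
  obtain ⟨f, hf, hf'⟩ := h w
  exact (hf K).2.symm.trans (hf' K).2

theorem equivalent_of_wt_eq {L : ℕ} {R R' : Fin L → Fin (n - 1)} (h : ∀ w, wt R w = wt R' w) :
    Equivalent R R' := fun w => ⟨_, isRationalForm_wt R w, h w ▸ isRationalForm_wt R' w⟩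

end BottSamelson

end

theorem mainTheorem3 (n : ℕ) :
    (∀ (L : ℕ) (R : Fin L → Fin (n - 1)),
      BottSamelson.heckeProduct R =
        ∑ x : Equiv.Perm (Fin n),
          (Polynomial.aeval BottSamelson.q (BottSamelson.wt R x)) •
            BottSamelson.heckeTTilde x) ∧
    (∀ (L : ℕ) (R R' : Fin L → Fin (n - 1)),
      (BottSamelson.Equivalent R R' ↔
        BottSamelson.heckeProduct R = BottSamelson.heckeProduct R') ∧
      ((∀ (K : Type) [Field K] [Finite K] (w : Equiv.Perm (Fin n)),
          BottSamelson.distribution K R w = BottSamelson.distribution K R' w) ↔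
        BottSamelson.heckeProduct R = BottSamelson.heckeProduct R')) := by
  refine ⟨fun L R => BottSamelson.heckeProduct_eq_sum R, fun L R R' => ?_⟩
  rw [BottSamelson.heckeProduct_eq_iff]
  exact ⟨⟨fun h => BottSamelson.wt_eq_of_distribution_eq h.distribution_eq,
      BottSamelson.equivalent_of_wt_eq⟩,
    ⟨BottSamelson.wt_eq_of_distribution_eq,
      fun h => (BottSamelson.equivalent_of_wt_eq h).distribution_eq⟩⟩
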